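/- Let $d,n\in\mathbb N$ and let $\mathcal Z$ be a set of possible data records. Let $\Theta\subseteq\mathbb R^d$ be a nonempty closed convex set (for instance $\Theta=\mathbb R^d$) and let $U\supseteq\Theta$ be an open convex set. For every $z\in\mathcal Z$ let $\ell(\cdot\,;z)$ be a real function that is convex and twice differentiable on $U$. Assume that there are real numbers $L,\eta$ and an integer $R\ge 1$ such that, for all $\theta\in\Theta$ and $z\in\mathcal Z$, $\|\nabla\ell(\theta;z)\|_2\le L$, every eigenvalue of the Hessian $\nabla^2\ell(\theta;z)$ is at most $\eta$, and $\operatorname{rank}\nabla^2\ell(\theta;z)\le R$. Let $\rho>0$, $q\in(0,1)$, $\Delta>0$ and $\sigma\in\mathbb R$ satisfy $$\Delta\ \ge\ \frac{\eta}{\exp\!\left(\frac{(1-q)\rho}{R}\right)-1},\qquad \sigma^2\ \ge\ \left(\frac{L\left(\sqrt{d+2q\rho}+\sqrt d\right)}{q\rho}\right)^2 .$$ Then for every dataset $Z=(z_1,\dots,z_n)\in\mathcal Z^n$ and every $b\in\mathbb R^d$ the function $$\theta\ \longmapsto\ \sum_{i=1}^n \ell(\theta;z_i)+\frac{\Delta}{2}\|\theta\|_2^2+b^\top\theta$$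 has exactly one minimizer over $\Theta$. Moreover, if $\hat\theta(Z)$ denotes this minimizer when $b\sim N(0,\sigma^2 I_d)$, then the randomized mechanism $Z\mapsto\hat\theta(Z)$ satisfies $\rho$-zero concentrated differential privacy ($\rho$-zCDP) under bounded adjacency: for all $Z,Z'\in\mathcal Z^n$ that differ in at most one entry and all $\alpha>1$, $$D_\alpha\big(\hat\theta(Z)\,\|\,\hat\theta(Z')\big)\ \le\ \rho\,\alpha ,$$ where $D_\alpha(P\|Q)=\frac1{\alpha-1}\log\int\left(\frac{dP}{dQ}\right)^{\alpha}dQ$ if $P\ll Q$, and $D_\alpha(P\|Q)=+\infty$ otherwise, is the Rényi divergence of order $\alpha$ of the law $P$ from the law $Q$. -/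

import Mathlib

open MeasureTheory ProbabilityTheory
open scoped ENNReal

noncomputable section

/-- The Rényi divergence `D_α(P ‖ Q) = (α - 1)⁻¹ log ∫ (dP/dQ)^α dQ` of order `α > 1`, with
values in the extended reals; it is `⊤` when `P` is not absolutely continuous with respect
to `Q`. When `P` and `Q` have densities `p` and `q` with respect to a common measure, the
integral is `∫ p^α q^(1-α)`. -/
def renyiDiv {Ω : Type*} [MeasurableSpace Ω] (α : ℝ) (P Q : Measure Ω) : EReal :=
  open Classical in
  if P ≪ Q then (((α - 1)⁻¹ : ℝ) : EReal) * ENNReal.log (∫⁻ x, (P.rnDeriv Q x) ^ α ∂Q) else ⊤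

/-- Bounded adjacency: two datasets with the same number of entries which differ in at most
one entry. -/
def BoundedNeighbors {D : Type*} {n : ℕ} (Z Z' : Fin n → D) : Prop :=
  ∃ t : Fin n, ∀ j : Fin n, j ≠ t → Z j = Z' j

/-- A randomized mechanism on datasets of size `n`, given by the law `M Z` of its output on the
dataset `Z`, satisfies `ρ`-zero concentrated differential privacy under bounded adjacency. -/
structure IsZCDP {D Ω : Type*} [MeasurableSpace Ω] {n : ℕ} (ρ : ℝ)
    (M : (Fin n → D) → Measure Ω) : Prop where
  isProbabilityMeasure : ∀ Z, IsProbabilityMeasure (M Z)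
  renyiDiv_le : ∀ Z Z', BoundedNeighbors Z Z' → ∀ α : ℝ, 1 < α →
    renyiDiv α (M Z) (M Z') ≤ ((ρ * α : ℝ) : EReal)

/-- The Hessian of `f` at `x`, as a linear operator: the derivative at `x` of the gradient. -/
def hessian {d : ℕ} (f : EuclideanSpace ℝ (Fin d) → ℝ) (x : EuclideanSpace ℝ (Fin d)) :
    EuclideanSpace ℝ (Fin d) →ₗ[ℝ] EuclideanSpace ℝ (Fin d) :=
  (fderiv ℝ (gradient f) x : EuclideanSpace ℝ (Fin d) →L[ℝ] EuclideanSpace ℝ (Fin d))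

/-- The perturbed objective `∑ i, ℓ(θ; Z i) + (Δ / 2) ‖θ‖² + bᵀ θ`. -/
def perturbedObjective {D : Type*} {d n : ℕ} (ℓ : EuclideanSpace ℝ (Fin d) → D → ℝ) (Δ : ℝ)
    (Z : Fin n → D) (b θ : EuclideanSpace ℝ (Fin d)) : ℝ :=
  (∑ i, ℓ θ (Z i)) + Δ / 2 * ‖θ‖ ^ 2 + inner ℝ b θ

/-- A minimizer over `Θ` of the perturbed objective (an arbitrary point if there is none). -/
def perturbedMinimizer {D : Type*} {d n : ℕ} (ℓ : EuclideanSpace ℝ (Fin d) → D → ℝ)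
    (Θ : Set (EuclideanSpace ℝ (Fin d))) (Δ : ℝ) (Z : Fin n → D)
    (b : EuclideanSpace ℝ (Fin d)) : EuclideanSpace ℝ (Fin d) :=
  Classical.epsilon fun θ => θ ∈ Θ ∧ IsMinOn (perturbedObjective ℓ Δ Z b) Θ θ

/-- Objective perturbation: the law of the minimizer over `Θ` of the perturbed objective, where
the perturbation `b` has the Gaussian law `N(0, σ² I)`. -/
def objectivePerturbation {D : Type*} {d n : ℕ} (ℓ : EuclideanSpace ℝ (Fin d) → D → ℝ)
    (Θ : Set (EuclideanSpace ℝ (Fin d))) (Δ σ : ℝ) (Z : Fin n → D) :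
    Measure (EuclideanSpace ℝ (Fin d)) :=
  (multivariateGaussian (0 : EuclideanSpace ℝ (Fin d))
    (σ ^ 2 • (1 : Matrix (Fin d) (Fin d) ℝ))).map (perturbedMinimizer ℓ Θ Δ Z)

end

/-!
The minimizer `θ` of the perturbed objective over `Θ` is characterized by the variational
inequality `⟪g θ + Δ θ + b, w - θ⟫ ≥ 0` for all `w ∈ Θ`, where `g` is the gradient of the sum of the
losses (`isMinOn_iff_isVISol`). Existence holds because the objective dominates a coercive
quadratic, and uniqueness because `g + Δ` is strongly monotone.

The law of `θ` need not have a density, since `Θ` may have empty interior and `θ` may charge its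
boundary. Therefore a normal vector is kept along with `θ`: with `p` the metric projection onto `Θ`,
the map `T y = -(Δ y + g (p y))` is a Lipschitz bijection of the whole space such that `θ = p y` when
`b = T y` (`perturbationMap`, `perturbationInv`). By the data processing inequality
(`lintegral_rnDeriv_map_rpow_le`) it suffices to bound the Rényi divergence between the laws of `y`.
By Rademacher's theorem and the change of variables formula, the law of `y` has the density
`|det DT(y)| φ(T y)`, with `φ` the Gaussian density (`map_withDensity_eq_of_lipschitzWith`).

At almost every `y` one has `DT = -(Δ + H P)`, where `H` is the Hessian of the sum of the losses at
`p y` and `P = Dp(y)` is symmetric with `‖P v‖² ≤ ⟪P v, v⟫`, since `p` is a gradient and firmly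
nonexpansive. Splitting off the Hessian `h` of the record that changes, `H = H₀ + h`, gives
`det (Δ + H P) = det (Δ + H₀ P) det (1 + h Q)` with `Q = P (Δ + H₀ P)⁻¹` symmetric and
`0 ≤ Q ≤ Δ⁻¹`. As `h` has rank at most `R` and `0 ≤ h ≤ η`, the last factor lies in
`[1, (1 + η / Δ) ^ R]` (`det_smul_add_comp_ratio`), so that the ratio of the two Jacobian
determinants is at most `exp ((1 - q) ρ)`.

The values of the two maps `T` at `y` differ by at most `2 L`. Hence the logarithm of the ratio of
the Gaussian densities is at most `(2 L ‖b‖ + 2 L²) / σ²`, and the bound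
`E exp (t ‖b‖) ≤ exp (t σ √d + (t σ)² / 2)` (`lintegral_exp_norm_multivariateGaussian_le`) shows that
it contributes at most `q ρ α` to the divergence of order `α`.
-/

open scoped RealInnerProductSpace Topology NNReal

section ConvexAnalysis

variable {E : Type*} [NormedAddCommGroup E] [InnerProductSpace ℝ E]

/-! ### Gradients and Hessians of convex functions -/

theorem ConvexOn.inner_gradient_le [CompleteSpace E] {f : E → ℝ} {U : Set E} {x y v : E}
    (hf : ConvexOn ℝ U f) (hx : x ∈ U) (hy : y ∈ U) (hv : HasGradientAt f v x) :
    ⟪v, y - x⟫ ≤ f y - f x := by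
  have hc := hf.comp_affineMap (AffineMap.lineMap x y)
  have hd : HasDerivAt (f ∘ (AffineMap.lineMap x y : ℝ →ᵃ[ℝ] E)) ⟪v, y - x⟫ 0 := by
    have h1 : HasFDerivAt f (InnerProductSpace.toDual ℝ E v)
        ((AffineMap.lineMap x y : ℝ →ᵃ[ℝ] E) 0) := by
      simpa using hv.hasFDerivAt
    simpa using h1.comp_hasDerivAt (0 : ℝ) AffineMap.hasDerivAt_lineMap
  have := hc.le_slope_of_hasDerivAt (by simpa using hx) (by simpa using hy)
    (zero_lt_one' ℝ) hd
  simpa [slope_def_field] using this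

/-- A derivative inherits the inequality `c ‖g y - g x‖² ≤ ⟪g y - g x, y - x⟫`. With `c = 0` this
turns monotonicity into positivity of the derivative. -/
theorem HasFDerivAt.mul_sq_norm_le_inner {g : E → E} {H : E →L[ℝ] E} {x : E} {c : ℝ}
    (hg : HasFDerivAt g H x)
    (hmono : ∀ᶠ y in 𝓝 x, c * ‖g y - g x‖ ^ 2 ≤ ⟪g y - g x, y - x⟫) (v : E) :
    c * ‖H v‖ ^ 2 ≤ ⟪H v, v⟫ := by
  have hlim : Filter.Tendsto (fun t : ℝ => t⁻¹ • (g (x + t • v) - g x)) (𝓝[≠] 0) (𝓝 (H v)) :=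
    (hg.hasLineDerivAt v).tendsto_slope_zero
  refine le_of_tendsto_of_tendsto ((hlim.norm.pow 2).const_mul c)
    (hlim.inner tendsto_const_nhds) ?_
  have hline : Filter.Tendsto (fun t : ℝ => x + t • v) (𝓝[≠] 0) (𝓝 x) := by
    have : Continuous fun t : ℝ => x + t • v := by fun_prop
    simpa using (this.tendsto 0).mono_left nhdsWithin_le_nhds
  filter_upwards [hline.eventually hmono, self_mem_nhdsWithin] with t ht ht0
  have ht0' : t ≠ 0 := ht0
  rw [add_sub_cancel_left, real_inner_smul_right] at ht
  rw [norm_smul, real_inner_smul_left, mul_pow, norm_inv, Real.norm_eq_abs, inv_pow, sq_abs]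
  have h2 : (0 : ℝ) < t ^ 2 := by positivity
  calc c * ((t ^ 2)⁻¹ * ‖g (x + t • v) - g x‖ ^ 2)
      = (t ^ 2)⁻¹ * (c * ‖g (x + t • v) - g x‖ ^ 2) := by ring
    _ ≤ (t ^ 2)⁻¹ * (t * ⟪g (x + t • v) - g x, v⟫) := by gcongr
    _ = t⁻¹ * ⟪g (x + t • v) - g x, v⟫ := by field_simp

theorem ConvexOn.inner_gradient_sub_nonneg [CompleteSpace E] {f : E → ℝ} {U : Set E} {x y v w : E}
    (hf : ConvexOn ℝ U f) (hx : x ∈ U) (hy : y ∈ U) (hv : HasGradientAt f v x)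
    (hw : HasGradientAt f w y) : 0 ≤ ⟪w - v, y - x⟫ := by
  have h1 := hf.inner_gradient_le hx hy hv
  have h2 := hf.inner_gradient_le hy hx hw
  rw [← neg_sub y x, inner_neg_right] at h2
  rw [inner_sub_left]
  linarith

/-- If `f` has gradient `g` near `x`, then the derivative of `g` at `x` is a symmetric operator. -/
theorem HasFDerivAt.isSymmetric_of_hasGradientAt [CompleteSpace E] {f : E → ℝ} {g : E → E}
    {H : E →L[ℝ] E} {x : E} (hf : ∀ᶠ y in 𝓝 x, HasGradientAt f (g y) y)
    (hg : HasFDerivAt g H x) : (H : E →ₗ[ℝ] E).IsSymmetric := by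
  intro v w
  have h1 : ∀ᶠ y in 𝓝 x, HasFDerivAt f (innerSL ℝ (g y)) y := hf.mono fun y hy => hy.hasFDerivAt
  have h2 : HasFDerivAt (fun y => innerSL ℝ (g y)) ((innerSL ℝ).comp H) x :=
    (innerSL ℝ : E →L[ℝ] StrongDual ℝ E).hasFDerivAt.comp x hg
  have h3 := second_derivative_symmetric_of_eventually_of_real h1 h2 v w
  simpa [real_inner_comm] using h3

theorem LinearMap.IsSymmetric.norm_le_of_inner_le {H : E →L[ℝ] E} {η : ℝ}
    (hH : (H : E →ₗ[ℝ] E).IsSymmetric) (hη : 0 ≤ η) (h0 : ∀ v, 0 ≤ ⟪H v, v⟫)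
    (h1 : ∀ v, ⟪H v, v⟫ ≤ η * ‖v‖ ^ 2) : ‖H‖ ≤ η := by
  refine H.opNorm_le_bound hη fun v => ?_
  -- positivity at `v - s H v` for every `s`
  have key : ∀ s : ℝ, 0 ≤ ⟪H v, v⟫ - 2 * s * ‖H v‖ ^ 2 + s ^ 2 * (η * ‖H v‖ ^ 2) := by
    intro s
    have h := h0 (v - s • H v)
    have hs : ⟪H (H v), v⟫ = ‖H v‖ ^ 2 := by
      rw [← real_inner_self_eq_norm_sq]; exact hH (H v) v
    rw [map_sub, map_smul, inner_sub_left, inner_sub_right, inner_sub_right, real_inner_smul_left,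
      real_inner_smul_left, real_inner_smul_right, real_inner_smul_right, hs,
      real_inner_self_eq_norm_sq] at h
    nlinarith [mul_le_mul_of_nonneg_left (h1 (H v)) (sq_nonneg s)]
  have hv := h1 v
  rcases hη.eq_or_lt with rfl | hη'
  · by_contra hcon
    have hpos : 0 < ‖H v‖ := by simpa using hcon
    have h := key 1
    have h2 : 0 < ‖H v‖ ^ 2 := by positivity
    linarith
  · have h := key η⁻¹
    have h3 : ‖H v‖ ^ 2 ≤ η * ⟪H v, v⟫ := by
      have : η⁻¹ ^ 2 * (η * ‖H v‖ ^ 2) = η⁻¹ * ‖H v‖ ^ 2 := by field_simp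
      rw [this] at h
      have h4 : 0 ≤ η * (⟪H v, v⟫ - 2 * η⁻¹ * ‖H v‖ ^ 2 + η⁻¹ * ‖H v‖ ^ 2) :=
        mul_nonneg hη h
      have h5 : η * (⟪H v, v⟫ - 2 * η⁻¹ * ‖H v‖ ^ 2 + η⁻¹ * ‖H v‖ ^ 2)
          = η * ⟪H v, v⟫ - ‖H v‖ ^ 2 := by field_simp; ring
      linarith
    refine abs_le_of_sq_le_sq' ?_ (by positivity) |>.2
    nlinarith

theorem LinearMap.IsSymmetric.inner_le_of_hasEigenvalue_le [FiniteDimensional ℝ E]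
    {H : E →ₗ[ℝ] E} {η : ℝ} (hH : H.IsSymmetric)
    (h : ∀ μ, Module.End.HasEigenvalue H μ → μ ≤ η) (v : E) : ⟪H v, v⟫ ≤ η * ‖v‖ ^ 2 := by
  set e := hH.eigenvectorBasis rfl
  rw [← e.sum_inner_mul_inner, ← e.sum_sq_inner_right v, Finset.mul_sum]
  refine Finset.sum_le_sum fun i _ => ?_
  have h1 : ⟪H v, e i⟫ = hH.eigenvalues rfl i * ⟪e i, v⟫ := by
    rw [hH v (e i), hH.apply_eigenvectorBasis rfl i, real_inner_comm]
    simp [real_inner_smul_left, e]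
  rw [h1, mul_assoc, ← sq]
  exact mul_le_mul_of_nonneg_right (h _ (hH.hasEigenvalue_eigenvalues rfl i)) (sq_nonneg _)

/-! ### Metric projection onto a closed convex set -/

/-- `p` is the metric projection onto the convex set `Θ`, encoded by the obtuse angle criterion:
`p y` is the point of `Θ` with `⟪y - p y, w - p y⟫ ≤ 0` for every `w ∈ Θ`. -/
structure IsConvexProj (Θ : Set E) (p : E → E) : Prop where
  mem : ∀ y, p y ∈ Θ
  inner_le : ∀ y, ∀ w ∈ Θ, ⟪y - p y, w - p y⟫ ≤ 0

theorem exists_isConvexProj [CompleteSpace E] {Θ : Set E} (hne : Θ.Nonempty) (hcl : IsClosed Θ)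
    (hconv : Convex ℝ Θ) : ∃ p, IsConvexProj Θ p := by
  choose p hp hmin using exists_norm_eq_iInf_of_complete_convex hne hcl.isComplete hconv
  exact ⟨p, hp, fun y => (norm_eq_iInf_iff_real_inner_le_zero hconv (hp y)).1 (hmin y)⟩

namespace IsConvexProj

variable {Θ : Set E} {p : E → E}

theorem eq_of_inner_le (hp : IsConvexProj Θ p) {y z : E} (hz : z ∈ Θ)
    (h : ∀ w ∈ Θ, ⟪y - z, w - z⟫ ≤ 0) : p y = z := by
  have h1 := hp.inner_le y z hz
  have h2 := h (p y) (hp.mem y)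
  have h3 : ‖p y - z‖ ^ 2 ≤ 0 := by
    rw [← real_inner_self_eq_norm_sq]
    have : ⟪p y - z, p y - z⟫ = ⟪y - p y, z - p y⟫ + ⟪y - z, p y - z⟫ := by
      rw [← neg_sub (p y) z, inner_neg_right, ← sub_eq_neg_add, ← inner_sub_left]
      congr 1; abel
    linarith
  have h4 : ‖p y - z‖ = 0 := by
    have := norm_nonneg (p y - z); nlinarith
  exact sub_eq_zero.1 (norm_eq_zero.1 h4)

/-- The projection is firmly nonexpansive. -/
theorem sq_norm_sub_le_inner (hp : IsConvexProj Θ p) (x y : E) :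
    ‖p x - p y‖ ^ 2 ≤ ⟪p x - p y, x - y⟫ := by
  have h1 := hp.inner_le x (p y) (hp.mem y)
  have h2 := hp.inner_le y (p x) (hp.mem x)
  rw [← real_inner_self_eq_norm_sq]
  have : ⟪p x - p y, x - y⟫ - ⟪p x - p y, p x - p y⟫
      = -(⟪x - p x, p y - p x⟫ + ⟪y - p y, p x - p y⟫) := by
    rw [← neg_sub (p x) (p y), inner_neg_right, ← sub_eq_neg_add, ← inner_sub_left,
      ← inner_sub_right, real_inner_comm, ← inner_neg_left]
    congr 1; abel
  linarith

theorem lipschitzWith (hp : IsConvexProj Θ p) : LipschitzWith 1 p := by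
  refine LipschitzWith.of_dist_le_mul fun x y => ?_
  rw [dist_eq_norm, dist_eq_norm, NNReal.coe_one, one_mul]
  have h := (hp.sq_norm_sub_le_inner x y).trans (real_inner_le_norm _ _)
  by_contra! hlt
  have := norm_nonneg (x - y)
  nlinarith

/-- The projection is the gradient of `y ↦ ⟪y, p y⟫ - ‖p y‖² / 2`, the supremum over `w ∈ Θ` of
`⟪y, w⟫ - ‖w‖² / 2`. -/
theorem hasGradientAt [CompleteSpace E] (hp : IsConvexProj Θ p) (y : E) :
    HasGradientAt (fun y => ⟪y, p y⟫ - ‖p y‖ ^ 2 / 2) (p y) y := by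
  have hsup : ∀ u v : E, ⟪u, p v⟫ - ‖p v‖ ^ 2 / 2 ≤ ⟪u, p u⟫ - ‖p u‖ ^ 2 / 2 := by
    intro u v
    have h1 := hp.inner_le u (p v) (hp.mem v)
    have h2 := sq_nonneg ‖p v - p u‖
    rw [norm_sub_sq_real] at h2
    rw [inner_sub_left, inner_sub_right, inner_sub_right, real_inner_self_eq_norm_sq] at h1
    have h3 := real_inner_comm (p u) (p v)
    linarith
  rw [hasGradientAt_iff_isLittleO]
  refine Asymptotics.IsBigO.trans_isLittleO (g := fun u => ‖u - y‖ ^ 2) ?_ ?_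
  · refine Asymptotics.IsBigO.of_bound 1 (Filter.Eventually.of_forall fun u => ?_)
    have h1 := hsup u y
    have h2 := hsup y u
    have h3 : ⟪p u - p y, u - y⟫ ≤ ‖u - y‖ ^ 2 := by
      have h := hp.lipschitzWith.dist_le_mul u y
      rw [dist_eq_norm, dist_eq_norm, NNReal.coe_one, one_mul] at h
      have h' := real_inner_le_norm (p u - p y) (u - y)
      nlinarith [norm_nonneg (u - y)]
    rw [inner_sub_left, inner_sub_right, inner_sub_right] at h3
    rw [inner_sub_right, Real.norm_eq_abs, norm_pow, norm_norm, one_mul, abs_le]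
    have e1 := real_inner_comm (p u) u
    have e2 := real_inner_comm (p u) y
    have e3 := real_inner_comm (p y) u
    have e4 := real_inner_comm (p y) y
    constructor <;> linarith [sq_nonneg ‖u - y‖]
  · have : (fun u : E => u - y) =o[𝓝 y] (fun _ => (1 : ℝ)) := by
      rw [Asymptotics.isLittleO_one_iff]
      exact Continuous.tendsto' (by fun_prop) y (0 : E) (by simp)
    have h := this.norm_left.mul_isBigO (Asymptotics.isBigO_refl (fun u : E => ‖u - y‖) (𝓝 y))
    simp only [one_mul, ← sq] at h
    exact h.of_norm_right

theorem isSymmetric_of_hasFDerivAt [CompleteSpace E] (hp : IsConvexProj Θ p) {P : E →L[ℝ] E}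
    {y : E} (hP : HasFDerivAt p P y) : (P : E →ₗ[ℝ] E).IsSymmetric :=
  hP.isSymmetric_of_hasGradientAt (Filter.Eventually.of_forall hp.hasGradientAt)

theorem sq_norm_le_inner_of_hasFDerivAt (hp : IsConvexProj Θ p) {P : E →L[ℝ] E}
    {y : E} (hP : HasFDerivAt p P y) (v : E) : ‖P v‖ ^ 2 ≤ ⟪P v, v⟫ := by
  simpa using hP.mul_sq_norm_le_inner (c := 1)
    (Filter.Eventually.of_forall fun z => by simpa using hp.sq_norm_sub_le_inner z y) v

end IsConvexProj

/-! ### Minimizers of regularized convex objectives -/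

section Minimizer

variable {Θ : Set E} {F : E → ℝ} {g : E → E} {Δ : ℝ}

/-- `x` solves the variational inequality of the operator `g + Δ + b` over `Θ`: this is the first
order optimality condition for the objective `F + Δ / 2 ‖·‖² + ⟪b, ·⟫` with `g = ∇F`. -/
def IsVISol (Θ : Set E) (g : E → E) (Δ : ℝ) (b x : E) : Prop :=
  x ∈ Θ ∧ ∀ w ∈ Θ, 0 ≤ ⟪g x + Δ • x + b, w - x⟫

/-- Solutions of the variational inequality depend on `b` in a Lipschitz way. -/
theorem IsVISol.mul_norm_sub_le {b c x y : E}
    (hmono : ∀ x ∈ Θ, ∀ y ∈ Θ, 0 ≤ ⟪g y - g x, y - x⟫)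
    (hx : IsVISol Θ g Δ b x) (hy : IsVISol Θ g Δ c y) : Δ * ‖x - y‖ ≤ ‖b - c‖ := by
  have h1 := hx.2 y hy.1
  have h2 := hy.2 x hx.1
  have h3 := hmono x hx.1 y hy.1
  have h4 : ⟪g x + Δ • x + b, y - x⟫ + ⟪g y + Δ • y + c, x - y⟫
      = - ⟪g y - g x, y - x⟫ - Δ * ‖x - y‖ ^ 2 + ⟪b - c, y - x⟫ := by
    rw [← real_inner_self_eq_norm_sq, ← neg_sub y x]
    simp only [inner_add_left, inner_sub_left, inner_neg_right, inner_neg_left,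
      real_inner_smul_left, inner_sub_right]
    ring
  have h5 := real_inner_le_norm (b - c) (y - x)
  rw [norm_sub_rev y x] at h5
  rcases (norm_nonneg (x - y)).eq_or_lt with h0 | h0
  · rw [← h0]; simp
  · have : Δ * ‖x - y‖ * ‖x - y‖ ≤ ‖b - c‖ * ‖x - y‖ := by nlinarith
    exact le_of_mul_le_mul_right this h0

theorem IsVISol.unique {b x y : E} (hΔ : 0 < Δ)
    (hmono : ∀ x ∈ Θ, ∀ y ∈ Θ, 0 ≤ ⟪g y - g x, y - x⟫)
    (hx : IsVISol Θ g Δ b x) (hy : IsVISol Θ g Δ b y) : x = y := by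
  have h := hx.mul_norm_sub_le hmono hy
  rw [sub_self, norm_zero] at h
  have : ‖x - y‖ = 0 := by have := norm_nonneg (x - y); nlinarith
  exact sub_eq_zero.1 (norm_eq_zero.1 this)

theorem le_objective_sub {b x w : E} (hgrad : ⟪g x, w - x⟫ ≤ F w - F x) :
    ⟪g x + Δ • x + b, w - x⟫ + Δ / 2 * ‖w - x‖ ^ 2 ≤
      (F w + Δ / 2 * ‖w‖ ^ 2 + ⟪b, w⟫) - (F x + Δ / 2 * ‖x‖ ^ 2 + ⟪b, x⟫) := by
  have h : ‖w‖ ^ 2 = ‖x‖ ^ 2 + 2 * ⟪x, w - x⟫ + ‖w - x‖ ^ 2 := by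
    rw [← norm_add_sq_real]; simp
  rw [inner_add_left, inner_add_left, real_inner_smul_left, h, inner_sub_right b]
  linarith

theorem isMinOn_iff_isVISol [CompleteSpace E] {b x : E} (hΔ : 0 ≤ Δ) (hconv : Convex ℝ Θ)
    (hx : x ∈ Θ) (hF : HasGradientAt F (g x) x)
    (hgrad : ∀ w ∈ Θ, ⟪g x, w - x⟫ ≤ F w - F x) :
    IsMinOn (fun θ => F θ + Δ / 2 * ‖θ‖ ^ 2 + ⟪b, θ⟫) Θ x ↔ IsVISol Θ g Δ b x := by
  constructor
  · refine fun h => ⟨hx, fun w hw => ?_⟩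
    have hd : HasFDerivAt (fun θ => F θ + Δ / 2 * ‖θ‖ ^ 2 + ⟪b, θ⟫)
        (InnerProductSpace.toDual ℝ E (g x) + (Δ / 2) • (2 • innerSL ℝ x) + innerSL ℝ b) x :=
      (hF.hasFDerivAt.add ((hasStrictFDerivAt_norm_sq x).hasFDerivAt.const_mul (Δ / 2))).add
        (innerSL ℝ b).hasFDerivAt
    have h1 := (IsMinOn.localize h).hasFDerivWithinAt_nonneg hd.hasFDerivWithinAt (y := w - x)
      (mem_posTangentConeAt_of_segment_subset (by
        simpa using hconv.segment_subset hx hw))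
    simp only [_root_.add_apply, _root_.smul_apply,
      InnerProductSpace.toDual_apply_apply, innerSL_apply_apply, nsmul_eq_mul, smul_eq_mul] at h1
    rw [inner_add_left, inner_add_left, real_inner_smul_left]
    push_cast at h1
    linarith
  · refine fun h w hw => ?_
    have h1 := le_objective_sub (Δ := Δ) (b := b) (hgrad w hw)
    have h2 := h.2 w hw
    have h3 : 0 ≤ Δ / 2 * ‖w - x‖ ^ 2 := by positivity
    simp only [Set.mem_ofPred_eq]
    linarith

theorem exists_isMinOn_objective [FiniteDimensional ℝ E] {b x : E} (hΔ : 0 < Δ) (hcl : IsClosed Θ)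
    (hx : x ∈ Θ) (hF : ContinuousOn F Θ) (hgrad : ∀ w ∈ Θ, ⟪g x, w - x⟫ ≤ F w - F x) :
    ∃ y ∈ Θ, IsMinOn (fun θ => F θ + Δ / 2 * ‖θ‖ ^ 2 + ⟪b, θ⟫) Θ y := by
  set J : E → ℝ := fun θ => F θ + Δ / 2 * ‖θ‖ ^ 2 + ⟪b, θ⟫
  have hJ : ContinuousOn J Θ :=
    (hF.add (Continuous.continuousOn (by fun_prop))).add (Continuous.continuousOn (by fun_prop))
  -- outside of this radius the quadratic term dominates the linear one
  set r := 2 * ‖g x + Δ • x + b‖ / Δ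
  have := FiniteDimensional.proper_real E
  refine hJ.exists_isMinOn' hcl hx ?_
  have hb : ∀ᶠ w in Filter.cocompact E ⊓ Filter.principal Θ, r ≤ ‖w - x‖ := by
    refine Filter.Eventually.filter_mono inf_le_left ?_
    filter_upwards [(isCompact_closedBall x r).compl_mem_cocompact] with w hw
    rw [Set.mem_compl_iff, Metric.mem_closedBall, dist_eq_norm, not_le] at hw
    exact hw.le
  filter_upwards [hb, Filter.mem_inf_of_right (Filter.mem_principal_self Θ)] with w hw hwΘ
  have h1 := le_objective_sub (Δ := Δ) (b := b) (hgrad w hwΘ)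
  have h2 := neg_le_of_abs_le (abs_real_inner_le_norm (g x + Δ • x + b) (w - x))
  have h3 : ‖g x + Δ • x + b‖ ≤ Δ / 2 * ‖w - x‖ := by
    rw [div_le_iff₀ hΔ] at hw; linarith
  have h4 := mul_le_mul_of_nonneg_right h3 (norm_nonneg (w - x))
  simp only [J]
  nlinarith

end Minimizer

end ConvexAnalysis

section Determinants

variable {E : Type*} [NormedAddCommGroup E] [InnerProductSpace ℝ E] [FiniteDimensional ℝ E]

/-! ### Determinants of low-rank perturbations -/

theorem LinearMap.IsSymmetric.det_one_add_mem_Icc {M : E →ₗ[ℝ] E} (hM : M.IsSymmetric) {κ : ℝ}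
    {R : ℕ} (h0 : ∀ v, 0 ≤ ⟪M v, v⟫) (h1 : ∀ v, ⟪M v, v⟫ ≤ κ * ‖v‖ ^ 2) (hκ : 0 ≤ κ)
    (hR : Module.finrank ℝ (LinearMap.range M) ≤ R) :
    LinearMap.det (1 + M) ∈ Set.Icc 1 ((1 + κ) ^ R) := by
  classical
  set e := hM.eigenvectorBasis rfl
  set lam : Fin (Module.finrank ℝ E) → ℝ := hM.eigenvalues rfl
  have happ : ∀ i, M (e i) = lam i • e i := fun i => hM.apply_eigenvectorBasis rfl i
  have hlam : ∀ i, ⟪M (e i), e i⟫ = lam i := fun i => by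
    rw [happ, real_inner_smul_left, real_inner_self_eq_norm_sq, e.orthonormal.1 i]; simp
  have hlam0 : ∀ i, 0 ≤ lam i := fun i => hlam i ▸ h0 (e i)
  have hlam1 : ∀ i, lam i ≤ κ := fun i => by
    have := h1 (e i)
    rwa [hlam, e.orthonormal.1 i, one_pow, mul_one] at this
  have hdet : LinearMap.det (1 + M) = ∏ i, (1 + lam i) := by
    rw [← LinearMap.det_toMatrix e.toBasis, ← Matrix.det_diagonal]
    congr 1
    ext i j
    rw [LinearMap.toMatrix_apply]
    simp only [OrthonormalBasis.coe_toBasis, LinearMap.add_apply, Module.End.one_apply, happ,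
      map_add, map_smul, Finsupp.add_apply, Finsupp.smul_apply, smul_eq_mul,
      Matrix.diagonal_apply]
    rw [← OrthonormalBasis.coe_toBasis, Module.Basis.repr_self, Finsupp.single_apply]
    by_cases h : i = j
    · subst h; simp
    · simp [h, Ne.symm h]
  rw [hdet]
  refine ⟨?_, ?_⟩
  · exact Finset.one_le_prod fun i _ => by linarith [hlam0 i]
  · -- eigenvectors with nonzero eigenvalue lie in the range
    have hcard : (Finset.univ.filter fun i => lam i ≠ 0).card ≤ R := by
      refine le_trans ?_ hR
      rw [← Fintype.card_subtype]
      have hmem : ∀ i : {i // lam i ≠ 0}, e i ∈ LinearMap.range M := fun i =>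
        ⟨(lam i)⁻¹ • e i, by rw [map_smul, happ, smul_smul, inv_mul_cancel₀ i.2, one_smul]⟩
      have hli : LinearIndependent ℝ
          (fun i : {i // lam i ≠ 0} => (⟨e i, hmem i⟩ : LinearMap.range M)) := by
        refine LinearIndependent.of_comp (LinearMap.range M).subtype ?_
        exact e.orthonormal.linearIndependent.comp _ Subtype.val_injective
      exact hli.fintype_card_le_finrank
    calc ∏ i, (1 + lam i) ≤ ∏ i, (if lam i ≠ 0 then 1 + κ else 1) := by
          refine Finset.prod_le_prod (fun i _ => by linarith [hlam0 i]) fun i _ => ?_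
          split_ifs with h
          · linarith [hlam1 i]
          · simp [not_not.1 h]
      _ = (1 + κ) ^ (Finset.univ.filter fun i => lam i ≠ 0).card := by
          rw [← Finset.prod_filter, Finset.prod_const]
      _ ≤ (1 + κ) ^ R := pow_le_pow_right₀ (by linarith) hcard

theorem LinearMap.IsSymmetric.exists_sqrt {Q : E →ₗ[ℝ] E} (hQ : Q.IsSymmetric)
    (h0 : ∀ v, 0 ≤ ⟪Q v, v⟫) : ∃ S : E →ₗ[ℝ] E, S.IsSymmetric ∧ S ∘ₗ S = Q := by
  set e := hQ.eigenvectorBasis rfl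
  set lam : Fin (Module.finrank ℝ E) → ℝ := hQ.eigenvalues rfl
  have happ : ∀ i, Q (e i) = lam i • e i := fun i => hQ.apply_eigenvectorBasis rfl i
  have hlam0 : ∀ i, 0 ≤ lam i := fun i => by
    have := h0 (e i)
    rwa [happ, real_inner_smul_left, real_inner_self_eq_norm_sq, e.orthonormal.1 i, one_pow,
      mul_one] at this
  let S : E →ₗ[ℝ] E := ∑ i, √(lam i) • (innerₗ E (e i)).smulRight (e i)
  have hS : ∀ v, S v = ∑ i, (√(lam i) * ⟪e i, v⟫) • e i := fun v => by
    simp [S, LinearMap.sum_apply, smul_smul]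
  have hSe : ∀ i, S (e i) = √(lam i) • e i := fun i => by
    classical
    rw [hS, Finset.sum_eq_single i]
    · rw [real_inner_self_eq_norm_sq, e.orthonormal.1 i]; simp
    · intro j _ hj; rw [e.orthonormal.2 hj]; simp
    · simp
  refine ⟨S, fun v w => ?_, ?_⟩
  · rw [hS, hS, sum_inner, inner_sum]
    refine Finset.sum_congr rfl fun i _ => ?_
    rw [real_inner_smul_left, real_inner_smul_right, real_inner_comm v]
    ring
  · refine e.toBasis.ext fun i => ?_
    rw [OrthonormalBasis.coe_toBasis, LinearMap.comp_apply, hSe, map_smul, hSe, smul_smul,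
      Real.mul_self_sqrt (hlam0 i), happ]

theorem LinearMap.det_one_add_comp_comm (A B : E →ₗ[ℝ] E) :
    LinearMap.det (1 + A ∘ₗ B) = LinearMap.det (1 + B ∘ₗ A) := by
  classical
  let b := Module.finBasis ℝ E
  rw [← LinearMap.det_toMatrix b, ← LinearMap.det_toMatrix b, map_add, map_add,
    LinearMap.toMatrix_comp b b b, LinearMap.toMatrix_comp b b b, LinearMap.toMatrix_one,
    Matrix.det_one_add_mul_comm]

/-- The generalization of `det (1 + M) ∈ [1, (1 + κ) ^ R]` to a product `M = h Q` of positive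
operators: with `S` the square root of `Q`, the determinant equals `det (1 + S h S)`. -/
theorem LinearMap.IsSymmetric.det_one_add_comp_mem_Icc {h Q : E →ₗ[ℝ] E} (hh : h.IsSymmetric)
    (hQ : Q.IsSymmetric) {η c : ℝ} {R : ℕ} (hη : 0 ≤ η) (hc : 0 ≤ c) (h0 : ∀ v, 0 ≤ ⟪h v, v⟫)
    (h1 : ∀ v, ⟪h v, v⟫ ≤ η * ‖v‖ ^ 2) (hR : Module.finrank ℝ (LinearMap.range h) ≤ R)
    (hQ0 : ∀ v, 0 ≤ ⟪Q v, v⟫) (hQ1 : ∀ v, ⟪Q v, v⟫ ≤ c * ‖v‖ ^ 2) :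
    LinearMap.det (1 + h ∘ₗ Q) ∈ Set.Icc 1 ((1 + η * c) ^ R) := by
  obtain ⟨S, hS, rfl⟩ := hQ.exists_sqrt hQ0
  rw [← LinearMap.comp_assoc, LinearMap.det_one_add_comp_comm]
  have hsq : ∀ v, ‖S v‖ ^ 2 = ⟪(S ∘ₗ S) v, v⟫ := fun v => by
    rw [← real_inner_self_eq_norm_sq, LinearMap.comp_apply, hS (S v) v]
  have hin : ∀ v, ⟪(S ∘ₗ h ∘ₗ S) v, v⟫ = ⟪h (S v), S v⟫ := fun v => hS _ _
  refine LinearMap.IsSymmetric.det_one_add_mem_Icc (fun v w => ?_) (fun v => ?_) (fun v => ?_)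
    (by positivity) ?_
  · simp only [LinearMap.comp_apply]
    rw [hS, hh, hS]
  · rw [hin]; exact h0 _
  · rw [hin]
    calc ⟪h (S v), S v⟫ ≤ η * ‖S v‖ ^ 2 := h1 _
      _ ≤ η * (c * ‖v‖ ^ 2) := by rw [hsq]; gcongr; exact hQ1 v
      _ = η * c * ‖v‖ ^ 2 := by ring
  · refine le_trans ?_ hR
    rw [LinearMap.range_comp]
    refine (Submodule.finrank_map_le _ _).trans ?_
    exact Submodule.finrank_mono (LinearMap.range_comp_le_range _ _)

/-- Adding to `Δ + H P` a term `h P`, with `h` positive of rank at most `R` and `h ≤ η`, multiplies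
the determinant by a factor in `[1, (1 + η / Δ) ^ R]`. Here `H ≥ 0` and `0 ≤ P ≤ 1`, so that
`Q = P (Δ + H P)⁻¹` is symmetric with `0 ≤ Q ≤ Δ⁻¹`, and the factor is `det (1 + h Q)`. -/
theorem det_smul_add_comp_ratio {H h P : E →ₗ[ℝ] E} {Δ η : ℝ} {R : ℕ} (hΔ : 0 < Δ) (hη : 0 ≤ η)
    (hH : H.IsSymmetric) (hH0 : ∀ v, 0 ≤ ⟪H v, v⟫) (hP : P.IsSymmetric)
    (hP1 : ∀ v, ‖P v‖ ^ 2 ≤ ⟪P v, v⟫) (hh : h.IsSymmetric) (h0 : ∀ v, 0 ≤ ⟪h v, v⟫)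
    (h1 : ∀ v, ⟪h v, v⟫ ≤ η * ‖v‖ ^ 2) (hR : Module.finrank ℝ (LinearMap.range h) ≤ R) :
    LinearMap.det (Δ • 1 + H ∘ₗ P) ≠ 0 ∧ ∃ r ∈ Set.Icc 1 ((1 + η / Δ) ^ R),
      LinearMap.det (Δ • 1 + (H + h) ∘ₗ P) = r * LinearMap.det (Δ • 1 + H ∘ₗ P) := by
  set A : E →ₗ[ℝ] E := Δ • 1 + H ∘ₗ P with hA
  have hAv : ∀ v, A v = Δ • v + H (P v) := fun v => by simp [hA]
  have hPA : ∀ v, Δ * ‖P v‖ ^ 2 ≤ ⟪P v, A v⟫ := fun v => by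
    rw [hAv, inner_add_right, real_inner_smul_right, real_inner_comm (H (P v))]
    nlinarith [hP1 v, hH0 (P v)]
  have hinj : Function.Injective A := by
    rw [injective_iff_map_eq_zero]
    intro v hv
    have h2 := hPA v
    rw [hv, inner_zero_right] at h2
    have h3 : P v = 0 := by
      rw [← norm_eq_zero]
      have := norm_nonneg (P v)
      by_contra hne
      have : 0 < ‖P v‖ ^ 2 := by positivity
      nlinarith
    have h4 := hAv v
    rw [hv, h3, map_zero, add_zero] at h4
    exact (smul_eq_zero.1 h4.symm).resolve_left hΔ.ne'
  let Ae := LinearEquiv.ofInjectiveEndo A hinj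
  have hAe : ∀ v, A (Ae.symm v) = v := fun v => Ae.apply_symm_apply v
  set Q : E →ₗ[ℝ] E := P ∘ₗ (Ae.symm : E →ₗ[ℝ] E) with hQ
  have hQA : Q ∘ₗ A = P := by
    ext v
    change P (Ae.symm (Ae v)) = P v
    rw [Ae.symm_apply_apply]
  have hQsym : Q.IsSymmetric := by
    intro v w
    have hv := hAe v
    have hw := hAe w
    change ⟪P (Ae.symm v), w⟫ = ⟪v, P (Ae.symm w)⟫
    set x := Ae.symm v
    set y := Ae.symm w
    rw [← hv, ← hw, hAv, hAv, inner_add_left, inner_add_right, real_inner_smul_left,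
      real_inner_smul_right, hP x y, hH (P x) (P y)]
  have hQ1 : ∀ v, Δ * ‖Q v‖ ^ 2 ≤ ⟪Q v, v⟫ := fun v => by
    have := hPA (Ae.symm v)
    rwa [hAe] at this
  have hQ0 : ∀ v, 0 ≤ ⟪Q v, v⟫ := fun v => le_trans (by positivity) (hQ1 v)
  have hQ2 : ∀ v, ⟪Q v, v⟫ ≤ Δ⁻¹ * ‖v‖ ^ 2 := fun v => by
    have h2 := hQ1 v
    have h3 := real_inner_le_norm (Q v) v
    have h4 : ‖Q v‖ ≤ Δ⁻¹ * ‖v‖ := by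
      rw [inv_mul_eq_div, le_div_iff₀ hΔ]
      by_contra! hlt
      have hpos : 0 < ‖Q v‖ := by
        by_contra hz
        have : ‖Q v‖ = 0 := le_antisymm (not_lt.1 hz) (norm_nonneg _)
        rw [this, zero_mul] at hlt
        exact absurd hlt (not_lt.2 (norm_nonneg v))
      nlinarith
    nlinarith [norm_nonneg v]
  refine ⟨?_, LinearMap.det (1 + h ∘ₗ Q), ?_, ?_⟩
  · have : LinearMap.det A = LinearMap.det (Ae : E →ₗ[ℝ] E) := rfl
    rw [this]
    exact (LinearEquiv.isUnit_det' Ae).ne_zero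
  · rw [div_eq_mul_inv]
    exact hh.det_one_add_comp_mem_Icc hQsym hη (inv_nonneg.2 hΔ.le) h0 h1 hR hQ0 hQ2
  · rw [← LinearMap.det_comp]
    congr 1
    refine LinearMap.ext fun v => ?_
    have hQv : Q (A v) = P v := LinearMap.congr_fun hQA v
    simp only [LinearMap.add_apply, LinearMap.comp_apply, LinearMap.smul_apply,
      Module.End.one_apply, hQv]
    rw [hAv]
    abel

end Determinants

section Gaussian

/-! ### Isotropic Gaussian measures -/

variable {d : ℕ}

/-- The density of the centered Gaussian law with covariance `v • 1` on Euclidean space. -/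
noncomputable def isoGaussianPDF (v : ℝ) (x : EuclideanSpace ℝ (Fin d)) : ℝ :=
  (2 * Real.pi * v) ^ (-(d / 2 : ℝ)) * Real.exp (-(2 * v)⁻¹ * ‖x‖ ^ 2)

theorem isoGaussianPDF_pos {v : ℝ} (hv : 0 < v) (x : EuclideanSpace ℝ (Fin d)) :
    0 < isoGaussianPDF v x := by
  unfold isoGaussianPDF; positivity

theorem continuous_isoGaussianPDF (v : ℝ) :
    Continuous (isoGaussianPDF v : EuclideanSpace ℝ (Fin d) → ℝ) := by
  unfold isoGaussianPDF; fun_prop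

theorem integrable_exp_neg_mul_sq_norm {b : ℝ} (hb : 0 < b) :
    Integrable (fun x : EuclideanSpace ℝ (Fin d) => Real.exp (-b * ‖x‖ ^ 2)) := by
  by_contra h
  have h1 := GaussianFourier.integral_rexp_neg_mul_sq_norm (V := EuclideanSpace ℝ (Fin d)) hb
  rw [integral_undef h] at h1
  have : 0 < (Real.pi / b) ^ ((Module.finrank ℝ (EuclideanSpace ℝ (Fin d)) : ℝ) / 2) := by
    positivity
  exact this.ne h1

theorem lintegral_exp_neg_mul_sq_norm {b : ℝ} (hb : 0 < b) :
    ∫⁻ x : EuclideanSpace ℝ (Fin d), ENNReal.ofReal (Real.exp (-b * ‖x‖ ^ 2)) =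
      ENNReal.ofReal ((Real.pi / b) ^ (d / 2 : ℝ)) := by
  rw [← ofReal_integral_eq_lintegral_ofReal (integrable_exp_neg_mul_sq_norm hb)
    (Filter.Eventually.of_forall fun x => (Real.exp_pos _).le),
    GaussianFourier.integral_rexp_neg_mul_sq_norm hb, finrank_euclideanSpace_fin]

theorem multivariateGaussian_eq_withDensity {v : ℝ} (hv : 0 < v) :
    multivariateGaussian (0 : EuclideanSpace ℝ (Fin d)) (v • (1 : Matrix (Fin d) (Fin d) ℝ)) =
      volume.withDensity fun x => ENNReal.ofReal (isoGaussianPDF v x) := by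
  have hv2 : 0 < (2 * v)⁻¹ := by positivity
  have hint : Integrable (isoGaussianPDF v : EuclideanSpace ℝ (Fin d) → ℝ) :=
    (integrable_exp_neg_mul_sq_norm hv2).const_mul _
  have : IsFiniteMeasure ((volume : Measure (EuclideanSpace ℝ (Fin d))).withDensity
      fun x => ENNReal.ofReal (isoGaussianPDF v x)) :=
    isFiniteMeasure_withDensity_ofReal hint.hasFiniteIntegral
  refine Measure.ext_of_charFun ?_
  ext t
  have hpsd : (v • (1 : Matrix (Fin d) (Fin d) ℝ)).PosSemidef := Matrix.PosSemidef.one.smul hv.le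
  rw [charFun_multivariateGaussian hpsd, charFun_apply,
    integral_withDensity_eq_integral_toReal_smul
      (continuous_isoGaussianPDF v).measurable.ennreal_ofReal
      (Filter.Eventually.of_forall fun x => ENNReal.ofReal_lt_top)]
  have h1 : ∀ x : EuclideanSpace ℝ (Fin d),
      (ENNReal.ofReal (isoGaussianPDF v x)).toReal • Complex.exp (⟪x, t⟫ * Complex.I) =
        (((2 * Real.pi * v) ^ (-(d / 2 : ℝ)) : ℝ) : ℂ) *
          Complex.exp (-((2 * v)⁻¹ : ℝ) * ‖x‖ ^ 2 + Complex.I * ⟪t, x⟫) := by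
    intro x
    rw [ENNReal.toReal_ofReal (isoGaussianPDF_pos hv x).le, isoGaussianPDF, Complex.exp_add,
      Complex.real_smul, real_inner_comm x t]
    push_cast
    ring_nf
  simp_rw [h1]
  rw [integral_const_mul, GaussianFourier.integral_cexp_neg_mul_sq_norm_add
    (by simpa using hv) Complex.I t, finrank_euclideanSpace_fin]
  have h2 : ((Real.pi : ℂ) / ((2 * v)⁻¹ : ℝ)) ^ (d / 2 : ℂ) =
      (((2 * Real.pi * v) ^ (d / 2 : ℝ) : ℝ) : ℂ) := by
    rw [Complex.ofReal_cpow (by positivity)]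
    push_cast
    congr 1
    field_simp
  rw [h2, ← mul_assoc, ← Complex.ofReal_mul, ← Real.rpow_add (by positivity), neg_add_cancel,
    Real.rpow_zero, Complex.ofReal_one, one_mul]
  congr 1
  have h3 : (t.ofLp ⬝ᵥ (v • (1 : Matrix (Fin d) (Fin d) ℝ)).mulVec t.ofLp) = v * ‖t‖ ^ 2 := by
    rw [Matrix.smul_mulVec, Matrix.one_mulVec, dotProduct_smul, smul_eq_mul,
      EuclideanSpace.real_norm_sq_eq]
    simp [dotProduct, sq]
  rw [h3]
  have hv' : (v : ℂ) ≠ 0 := by exact_mod_cast hv.ne'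
  simp
  field_simp
  ring

/-- The exponential moments of the norm of a Gaussian vector `x` with covariance `σ² • 1`. With
`c = √d + t σ`, the elementary bound `t σ ‖g‖ ≤ t σ (‖g‖² / c + c) / 2` for `g = x / σ` reduces the
claim to the exponential moment of `‖g‖²`, a Gaussian integral. -/
theorem lintegral_exp_norm_multivariateGaussian_le (hd : 0 < d) {σ t : ℝ} (hσ : 0 < σ)
    (ht : 0 ≤ t) :
    ∫⁻ x, ENNReal.ofReal (Real.exp (t * ‖x‖))
        ∂(multivariateGaussian (0 : EuclideanSpace ℝ (Fin d))
          (σ ^ 2 • (1 : Matrix (Fin d) (Fin d) ℝ))) ≤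
      ENNReal.ofReal (Real.exp (t * σ * √d + (t * σ) ^ 2 / 2)) := by
  have hv : 0 < σ ^ 2 := by positivity
  have hs : 0 < √(d : ℝ) := Real.sqrt_pos.2 (by exact_mod_cast hd)
  have hss : √(d : ℝ) ^ 2 = d := Real.sq_sqrt (by positivity)
  set s := √(d : ℝ)
  set τ := t * σ with hτ
  have hτ0 : 0 ≤ τ := by positivity
  set c := s + τ with hc
  have hc0 : 0 < c := by positivity
  set K := (2 * Real.pi * σ ^ 2) ^ (-(d / 2 : ℝ)) with hK
  set β := (2 * σ ^ 2)⁻¹ * (s / c) with hβ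
  have hβ0 : 0 < β := by positivity
  rw [multivariateGaussian_eq_withDensity hv, lintegral_withDensity_eq_lintegral_mul _
    (continuous_isoGaussianPDF _).measurable.ennreal_ofReal
    (by fun_prop : Continuous fun x : EuclideanSpace ℝ (Fin d) =>
      Real.exp (t * ‖x‖)).measurable.ennreal_ofReal]
  calc ∫⁻ x : EuclideanSpace ℝ (Fin d), _
      ≤ ∫⁻ x : EuclideanSpace ℝ (Fin d), ENNReal.ofReal (K * Real.exp (τ * c / 2)) *
          ENNReal.ofReal (Real.exp (-β * ‖x‖ ^ 2)) := by
        refine lintegral_mono fun x => ?_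
        rw [Pi.mul_apply, ← ENNReal.ofReal_mul (isoGaussianPDF_pos hv x).le,
          ← ENNReal.ofReal_mul (by positivity), isoGaussianPDF, ← hK, mul_assoc, mul_assoc,
          ← Real.exp_add, ← Real.exp_add]
        refine ENNReal.ofReal_le_ofReal (mul_le_mul_of_nonneg_left (Real.exp_le_exp.2 ?_)
          (by positivity))
        have h1 : 0 ≤ t * (‖x‖ - c * σ) ^ 2 / (2 * c * σ) := by positivity
        have h2 : t * (‖x‖ - c * σ) ^ 2 / (2 * c * σ) =
            τ * c / 2 - t * ‖x‖ + ((2 * σ ^ 2)⁻¹ - β) * ‖x‖ ^ 2 := by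
          have h3 : (2 * σ ^ 2)⁻¹ - β = t / (2 * c * σ) := by
            rw [hβ]
            field_simp
            rw [hc, hτ]; ring
          rw [h3, hτ]
          field_simp
          ring
        linarith
    _ = ENNReal.ofReal (K * Real.exp (τ * c / 2) * (Real.pi / β) ^ (d / 2 : ℝ)) := by
        rw [lintegral_const_mul _ (by fun_prop : Continuous fun x : EuclideanSpace ℝ (Fin d) =>
          Real.exp (-β * ‖x‖ ^ 2)).measurable.ennreal_ofReal, lintegral_exp_neg_mul_sq_norm hβ0,
          ← ENNReal.ofReal_mul (by positivity)]
    _ ≤ _ := by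
        refine ENNReal.ofReal_le_ofReal ?_
        have h1 : Real.pi / β = 2 * Real.pi * σ ^ 2 * (1 + τ / s) := by
          rw [hβ, hc]; field_simp
        rw [h1, Real.mul_rpow (by positivity) (by positivity)]
        have h2 : K * Real.exp (τ * c / 2) *
            ((2 * Real.pi * σ ^ 2) ^ (d / 2 : ℝ) * (1 + τ / s) ^ (d / 2 : ℝ)) =
            Real.exp (τ * c / 2) * (1 + τ / s) ^ (d / 2 : ℝ) := by
          have : K * (2 * Real.pi * σ ^ 2) ^ (d / 2 : ℝ) = 1 := by
            rw [hK, ← Real.rpow_add (by positivity), neg_add_cancel, Real.rpow_zero]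
          linear_combination (Real.exp (τ * c / 2) * (1 + τ / s) ^ (d / 2 : ℝ)) * this
        rw [h2]
        have h3 : (1 + τ / s) ^ (d / 2 : ℝ) ≤ Real.exp (τ / s * (d / 2)) := by
          rw [Real.exp_mul]
          exact Real.rpow_le_rpow (by positivity) (by linarith [Real.add_one_le_exp (τ / s)])
            (by positivity)
        calc Real.exp (τ * c / 2) * (1 + τ / s) ^ (d / 2 : ℝ)
            ≤ Real.exp (τ * c / 2) * Real.exp (τ / s * (d / 2)) := by gcongr
          _ = Real.exp (τ * s + τ ^ 2 / 2) := by
              rw [← Real.exp_add, ← hss, hc]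
              congr 1
              field_simp
              ring

end Gaussian

section Renyi

/-! ### Rényi divergence -/

variable {Ω Ω' : Type*} [MeasurableSpace Ω] [MeasurableSpace Ω']

/-- The data processing inequality for the moments of the likelihood ratio. The ratio `r` of the
images satisfies `∫ r ^ α = ∫ r ^ (α - 1) dP ≤ (∫ r ^ α) ^ (1 - 1 / α) (∫ (dP/dQ) ^ α) ^ (1 / α)` by
Hölder's inequality; as `∫ r ^ α` might be infinite, this is applied to the truncations
`min r n`. -/
theorem lintegral_rnDeriv_map_rpow_le {P Q : Measure Ω} [IsFiniteMeasure P] [IsFiniteMeasure Q]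
    (hPQ : P ≪ Q) {f : Ω → Ω'} (hf : Measurable f) {α : ℝ} (hα : 1 < α) :
    ∫⁻ y, ((P.map f).rnDeriv (Q.map f) y) ^ α ∂(Q.map f) ≤ ∫⁻ x, (P.rnDeriv Q x) ^ α ∂Q := by
  have hα0 : 0 < α := by linarith
  have hα1 : 0 < α - 1 := by linarith
  set r := (P.map f).rnDeriv (Q.map f) with hr
  have hrm : Measurable r := Measure.measurable_rnDeriv _ _
  have hPQf : P.map f ≪ Q.map f := hPQ.map hf
  set Y := ∫⁻ x, (P.rnDeriv Q x) ^ α ∂Q with hY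
  have hbound : ∀ n : ℕ, ∫⁻ y, (min (r y) n) ^ α ∂(Q.map f) ≤ Y := by
    intro n
    set rn : Ω' → ℝ≥0∞ := fun y => min (r y) n with hrn
    have hrnm : Measurable rn := hrm.min measurable_const
    set X := ∫⁻ y, (rn y) ^ α ∂(Q.map f) with hX
    have hXtop : X ≠ ∞ := by
      refine ne_of_lt (lt_of_le_of_lt (lintegral_mono (g := fun _ => (n : ℝ≥0∞) ^ α)
        fun y => ENNReal.rpow_le_rpow (min_le_right _ _) hα0.le) ?_)
      rw [lintegral_const]
      exact ENNReal.mul_lt_top (ENNReal.rpow_lt_top_of_nonneg hα0.le (ENNReal.natCast_ne_top n))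
        (measure_lt_top _ _)
    have h1 : X ≤ ∫⁻ x, rn (f x) ^ (α - 1) * P.rnDeriv Q x ∂Q := by
      calc X ≤ ∫⁻ y, r y * rn y ^ (α - 1) ∂(Q.map f) := by
            refine lintegral_mono fun y => ?_
            have : rn y ^ α = rn y * rn y ^ (α - 1) := by
              conv_lhs => rw [show α = 1 + (α - 1) by ring]
              rw [ENNReal.rpow_add_of_nonneg _ _ zero_le_one hα1.le, ENNReal.rpow_one]
            rw [this]
            gcongr
            exact min_le_left _ _
        _ = ∫⁻ y, rn y ^ (α - 1) ∂(P.map f) := by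
            conv_rhs => rw [← Measure.withDensity_rnDeriv_eq _ _ hPQf]
            rw [lintegral_withDensity_eq_lintegral_mul _ hrm (hrnm.pow_const _)]
            rfl
        _ = ∫⁻ x, rn (f x) ^ (α - 1) ∂P := lintegral_map (hrnm.pow_const _) hf
        _ = ∫⁻ x, rn (f x) ^ (α - 1) * P.rnDeriv Q x ∂Q := by
            conv_lhs => rw [← Measure.withDensity_rnDeriv_eq _ _ hPQ]
            refine (lintegral_withDensity_eq_lintegral_mul _ (Measure.measurable_rnDeriv _ _)
              ((hrnm.comp hf).pow_const _)).trans ?_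
            exact lintegral_congr fun x => mul_comm _ _
    have hconj : (α / (α - 1)).HolderConjugate α :=
      (Real.HolderConjugate.conjExponent hα).symm
    have h2 : X ≤ X ^ (1 - 1 / α) * Y ^ (1 / α) := by
      refine h1.trans ((ENNReal.lintegral_mul_le_Lp_mul_Lq Q hconj
        ((hrnm.comp hf).pow_const _).aemeasurable
        (Measure.measurable_rnDeriv P Q).aemeasurable).trans_eq ?_)
      have h3 : ∫⁻ x, (rn (f x) ^ (α - 1)) ^ (α / (α - 1)) ∂Q = X := by
        rw [hX, lintegral_map (hrnm.pow_const _) hf]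
        refine lintegral_congr fun x => ?_
        rw [← ENNReal.rpow_mul]
        congr 1
        field_simp
      have h4 : 1 / (α / (α - 1)) = 1 - 1 / α := by field_simp
      rw [h4]
      exact congrArg (fun z => z ^ (1 - 1 / α) * Y ^ (1 / α)) h3
    by_cases hX0 : X = 0
    · rw [hX0]; exact zero_le
    have h5 : X ^ (1 / α) ≤ Y ^ (1 / α) := by
      have h6 : X = X ^ (1 - 1 / α) * X ^ (1 / α) := by
        rw [← ENNReal.rpow_add _ _ hX0 hXtop]; simp
      have h7 : X ^ (1 - 1 / α) * X ^ (1 / α) ≤ X ^ (1 - 1 / α) * Y ^ (1 / α) := h6 ▸ h2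
      rwa [ENNReal.mul_le_mul_iff_right (by simp [hX0, hXtop])
        (ENNReal.rpow_ne_top_of_ne_zero hX0 hXtop)] at h7
    exact (ENNReal.rpow_le_rpow_iff (by positivity)).1 h5
  refine le_of_tendsto' (lintegral_tendsto_of_tendsto_of_monotone
    (f := fun n : ℕ => fun y => (min (r y) n) ^ α)
    (fun n => ((hrm.min measurable_const).pow_const _).aemeasurable) ?_ ?_) hbound
  · refine Filter.Eventually.of_forall fun y m n hmn => ?_
    exact ENNReal.rpow_le_rpow (min_le_min le_rfl (by exact_mod_cast hmn)) hα0.le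
  · refine Filter.Eventually.of_forall fun y => ?_
    have h1 : Filter.Tendsto (fun n : ℕ => min (r y) (n : ℝ≥0∞)) Filter.atTop (𝓝 (min (r y) ∞)) :=
      tendsto_const_nhds.min ENNReal.tendsto_nat_nhds_top
    rw [min_eq_left le_top] at h1
    exact (ENNReal.continuous_rpow_const.tendsto _).comp h1

theorem withDensity_eq_withDensity_div {μ : Measure Ω} {p q : Ω → ℝ≥0∞} (hp : Measurable p)
    (hq : Measurable q) (hq0 : ∀ᵐ x ∂μ, q x ≠ 0) (hq1 : ∀ᵐ x ∂μ, q x ≠ ∞) :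
    μ.withDensity p = (μ.withDensity q).withDensity (fun x => p x / q x) := by
  refine Eq.trans ?_ (withDensity_mul μ hq (hp.div hq))
  refine withDensity_congr_ae ?_
  filter_upwards [hq0, hq1] with x h0 h1
  exact (ENNReal.mul_div_cancel h0 h1).symm

theorem lintegral_rnDeriv_withDensity_rpow {μ : Measure Ω} {p q : Ω → ℝ≥0∞} (hp : Measurable p)
    (hq : Measurable q) (hq0 : ∀ᵐ x ∂μ, q x ≠ 0) (hq1 : ∀ᵐ x ∂μ, q x ≠ ∞)
    [SigmaFinite (μ.withDensity q)] {α : ℝ} (hα : 1 < α) :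
    ∫⁻ x, ((μ.withDensity p).rnDeriv (μ.withDensity q) x) ^ α ∂(μ.withDensity q) =
      ∫⁻ x, (p x / q x) ^ (α - 1) ∂(μ.withDensity p) := by
  have hm : Measurable fun x => p x / q x := hp.div hq
  rw [withDensity_eq_withDensity_div hp hq hq0 hq1,
    lintegral_withDensity_eq_lintegral_mul _ hm (hm.pow_const _)]
  refine lintegral_congr_ae ?_
  filter_upwards [Measure.rnDeriv_withDensity (μ.withDensity q) hm] with x hx
  rw [hx, Pi.mul_apply]
  conv_lhs => rw [show α = 1 + (α - 1) by ring]
  rw [ENNReal.rpow_add_of_nonneg _ _ zero_le_one (by linarith), ENNReal.rpow_one]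

theorem renyiDiv_le_of_lintegral_le {P Q : Measure Ω} {α c : ℝ} (hα : 1 < α) (hPQ : P ≪ Q)
    (h : ∫⁻ x, (P.rnDeriv Q x) ^ α ∂Q ≤ ENNReal.ofReal (Real.exp ((α - 1) * c))) :
    renyiDiv α P Q ≤ (c : EReal) := by
  have hα1 : 0 < α - 1 := by linarith
  rw [renyiDiv, if_pos hPQ]
  have h1 : ENNReal.log (∫⁻ x, (P.rnDeriv Q x) ^ α ∂Q) ≤ (((α - 1) * c : ℝ) : EReal) := by
    refine (ENNReal.log_le_log h).trans_eq ?_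
    rw [ENNReal.log_ofReal_of_pos (Real.exp_pos _), Real.log_exp]
  refine (mul_le_mul_of_nonneg_left h1 (by exact_mod_cast (inv_nonneg.2 hα1.le))).trans_eq ?_
  rw [← EReal.coe_mul]
  congr 1
  field_simp

theorem renyiDiv_self_le {P : Measure Ω} [IsProbabilityMeasure P] {α c : ℝ} (hα : 1 < α)
    (hc : 0 ≤ c) : renyiDiv α P P ≤ (c : EReal) := by
  refine renyiDiv_le_of_lintegral_le hα Measure.AbsolutelyContinuous.rfl ?_
  have h1 : ∫⁻ x, (P.rnDeriv P x) ^ α ∂P = 1 := by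
    rw [lintegral_congr_ae (g := fun _ => 1), lintegral_one, measure_univ]
    filter_upwards [Measure.rnDeriv_self P] with x hx
    rw [hx, ENNReal.one_rpow]
  rw [h1, ← ENNReal.ofReal_one]
  refine ENNReal.ofReal_le_ofReal (Real.one_le_exp (mul_nonneg (by linarith) hc))

/-- Post-processing: the divergence between the images of `μ.withDensity p` and `μ.withDensity q`
is bounded through the moment `∫ (p / q) ^ (α - 1)` under `μ.withDensity p`. -/
theorem renyiDiv_map_withDensity_le {μ : Measure Ω} {p q : Ω → ℝ≥0∞} (hp : Measurable p)
    (hq : Measurable q) (hq0 : ∀ᵐ x ∂μ, q x ≠ 0) (hq1 : ∀ᵐ x ∂μ, q x ≠ ∞)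
    [IsFiniteMeasure (μ.withDensity p)] [IsFiniteMeasure (μ.withDensity q)] {f : Ω → Ω'}
    (hf : Measurable f) {α c : ℝ} (hα : 1 < α)
    (h : ∫⁻ x, (p x / q x) ^ (α - 1) ∂(μ.withDensity p) ≤
      ENNReal.ofReal (Real.exp ((α - 1) * c))) :
    renyiDiv α ((μ.withDensity p).map f) ((μ.withDensity q).map f) ≤ (c : EReal) := by
  have hPQ : μ.withDensity p ≪ μ.withDensity q := by
    rw [withDensity_eq_withDensity_div hp hq hq0 hq1]
    exact withDensity_absolutelyContinuous _ _
  refine renyiDiv_le_of_lintegral_le hα (hPQ.map hf) ?_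
  exact (lintegral_rnDeriv_map_rpow_le hPQ hf hα).trans
    ((lintegral_rnDeriv_withDensity_rpow hp hq hq0 hq1 hα).trans_le h)

end Renyi

section ChangeOfVariables

/-! ### Change of variables for Lipschitz bijections -/

theorem LipschitzWith.volume_image_eq_zero {E : Type*} [NormedAddCommGroup E]
    [InnerProductSpace ℝ E] [FiniteDimensional ℝ E] [MeasurableSpace E] [BorelSpace E]
    {T : E → E} {K : ℝ≥0} (hT : LipschitzWith K T) {s : Set E} (hs : volume s = 0) :
    volume (T '' s) = 0 := by
  have h1 : (volume : Measure E) ≪ μH[(Module.finrank ℝ E : ℝ)] :=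
    Measure.absolutelyContinuous_isAddHaarMeasure _ _
  have h2 : μH[(Module.finrank ℝ E : ℝ)] ≪ (volume : Measure E) :=
    Measure.absolutelyContinuous_isAddHaarMeasure _ _
  refine h1 (le_antisymm ?_ zero_le)
  refine ((hT.lipschitzOnWith (s := s)).hausdorffMeasure_image_le (Nat.cast_nonneg _)).trans ?_
  rw [h2 hs, mul_zero]

/-- The image of a law with density `φ` under the inverse `Y` of a Lipschitz bijection `T` has
density `|det DT| φ ∘ T`. By Rademacher's theorem `T` is differentiable outside of a null set,
which `T` maps to a null set. -/
theorem map_withDensity_eq_of_lipschitzWith {E : Type*} [NormedAddCommGroup E]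
    [InnerProductSpace ℝ E] [FiniteDimensional ℝ E] [MeasurableSpace E] [BorelSpace E]
    {T Y : E → E} {K : ℝ≥0} (hT : LipschitzWith K T) (hY : Measurable Y)
    (hYT : Function.LeftInverse Y T) (hTY : Function.RightInverse Y T) (φ : E → ℝ≥0∞) :
    (volume.withDensity φ).map Y =
      volume.withDensity fun y => ENNReal.ofReal |(fderiv ℝ T y).det| * φ (T y) := by
  have hinj : Function.Injective T := hYT.injective
  set S := {y | DifferentiableAt ℝ T y} with hS
  have hSm : MeasurableSet S := measurableSet_of_differentiableAt ℝ T
  have hSc : volume Sᶜ = 0 := hT.ae_differentiableAt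
  ext A hA
  rw [Measure.map_apply hY hA, withDensity_apply _ (hY hA), withDensity_apply _ hA]
  have himg : Y ⁻¹' A = T '' A := (Set.image_eq_preimage_of_inverse hYT hTY ▸ rfl)
  have h1 : (T '' A : Set E) =ᵐ[volume] (T '' (A ∩ S) : Set E) := by
    have hsub : T '' A ⊆ T '' (A ∩ S) ∪ T '' Sᶜ := by
      rintro _ ⟨y, hy, rfl⟩
      by_cases hyS : y ∈ S
      · exact Or.inl ⟨y, ⟨hy, hyS⟩, rfl⟩
      · exact Or.inr ⟨y, hyS, rfl⟩
    refine Filter.EventuallyLE.antisymm ?_ (Set.image_mono Set.inter_subset_left).eventuallyLE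
    rw [ae_le_set]
    exact measure_mono_null (Set.sdiff_subset_iff.2 hsub) (hT.volume_image_eq_zero hSc)
  have h2 : (A ∩ S : Set E) =ᵐ[volume] A := by
    refine Filter.EventuallyLE.antisymm (Set.inter_subset_left).eventuallyLE ?_
    rw [ae_le_set, Set.sdiff_self_inter]
    exact measure_mono_null (fun x hx => hx.2) hSc
  rw [himg, setLIntegral_congr h1, lintegral_image_eq_lintegral_abs_det_fderiv_mul volume
    (hA.inter hSm) (fun y hy => hy.2.hasFDerivAt.hasFDerivWithinAt) hinj.injOn,
    setLIntegral_congr h2]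

end ChangeOfVariables

section Privacy

variable {E : Type*} [NormedAddCommGroup E] [InnerProductSpace ℝ E]

/-! ### The map from the normal bundle of the constraint set to the perturbation -/

/-- The map `y ↦ -(Δ y + g (p y))`, for `p` the projection onto `Θ`. Writing `y = θ + ν / Δ` with
`θ = p y` and `ν = Δ (y - p y)` a normal vector of `Θ` at `θ`, its value is the perturbation
`b = -(g θ + Δ θ + ν)` for which `θ` is the solution of the variational inequality. -/
def perturbationMap (p g : E → E) (Δ : ℝ) (y : E) : E := -(Δ • y + g (p y))

variable {Θ : Set E} {p g θ : E → E} {Δ : ℝ}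

theorem exists_lipschitzWith_perturbationMap {K : ℝ≥0} (hp : IsConvexProj Θ p)
    (hg : LipschitzOnWith K g Θ) : ∃ K', LipschitzWith K' (perturbationMap p g Δ) := by
  have h1 : LipschitzWith (K * 1) (g ∘ p) := by
    rw [← lipschitzOnWith_univ]
    exact hg.comp (hp.lipschitzWith.lipschitzOnWith) fun y _ => hp.mem y
  exact ⟨_, ((lipschitzWith_smul Δ).add h1).neg⟩

theorem isVISol_perturbationMap (hp : IsConvexProj Θ p) (hΔ : 0 ≤ Δ) (y : E) :
    IsVISol Θ g Δ (perturbationMap p g Δ y) (p y) := by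
  refine ⟨hp.mem y, fun w hw => ?_⟩
  have h : g (p y) + Δ • p y + perturbationMap p g Δ y = -(Δ • (y - p y)) := by
    rw [perturbationMap, smul_sub]; abel
  rw [h, inner_neg_left, real_inner_smul_left]
  have := hp.inner_le y w hw
  nlinarith

/-- The inverse of `perturbationMap p g Δ`, in terms of the solution map `θ` of the variational
inequality. -/
noncomputable def perturbationInv (g θ : E → E) (Δ : ℝ) (b : E) : E := -(Δ⁻¹ • (b + g (θ b)))

theorem proj_perturbationInv (hp : IsConvexProj Θ p) (hΔ : 0 < Δ)
    (hθ : ∀ b, IsVISol Θ g Δ b (θ b)) (b : E) : p (perturbationInv g θ Δ b) = θ b := by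
  refine hp.eq_of_inner_le (hθ b).1 fun w hw => ?_
  have h : perturbationInv g θ Δ b - θ b = -(Δ⁻¹ • (g (θ b) + Δ • θ b + b)) := by
    rw [perturbationInv, smul_add, smul_add, smul_add, smul_smul, inv_mul_cancel₀ hΔ.ne', one_smul]
    abel
  rw [h, inner_neg_left, real_inner_smul_left, neg_nonpos]
  exact mul_nonneg (inv_nonneg.2 hΔ.le) ((hθ b).2 w hw)

theorem perturbationMap_perturbationInv (hp : IsConvexProj Θ p) (hΔ : 0 < Δ)
    (hθ : ∀ b, IsVISol Θ g Δ b (θ b)) :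
    Function.RightInverse (perturbationInv g θ Δ) (perturbationMap p g Δ) := by
  intro b
  rw [perturbationMap, proj_perturbationInv hp hΔ hθ, perturbationInv, smul_neg, smul_smul,
    mul_inv_cancel₀ hΔ.ne', one_smul]
  abel

theorem perturbationInv_perturbationMap (hp : IsConvexProj Θ p) (hΔ : 0 < Δ)
    (hmono : ∀ x ∈ Θ, ∀ y ∈ Θ, 0 ≤ ⟪g y - g x, y - x⟫)
    (hθ : ∀ b, IsVISol Θ g Δ b (θ b)) :
    Function.LeftInverse (perturbationInv g θ Δ) (perturbationMap p g Δ) := by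
  intro y
  have h : θ (perturbationMap p g Δ y) = p y :=
    (hθ _).unique hΔ hmono (isVISol_perturbationMap hp hΔ.le y)
  rw [perturbationInv, h, perturbationMap, neg_add, neg_add_cancel_right, smul_neg, neg_neg,
    smul_smul, inv_mul_cancel₀ hΔ.ne', one_smul]

theorem continuous_of_isVISol (hΔ : 0 < Δ)
    (hmono : ∀ x ∈ Θ, ∀ y ∈ Θ, 0 ≤ ⟪g y - g x, y - x⟫)
    (hθ : ∀ b, IsVISol Θ g Δ b (θ b)) : Continuous θ := by
  refine (LipschitzWith.of_dist_le_mul (K := Real.toNNReal Δ⁻¹) fun b c => ?_).continuous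
  rw [dist_eq_norm, dist_eq_norm, Real.coe_toNNReal _ (inv_nonneg.2 hΔ.le), inv_mul_eq_div,
    le_div_iff₀ hΔ, mul_comm]
  exact (hθ b).mul_norm_sub_le hmono (hθ c)

theorem continuous_perturbationInv {K : ℝ≥0} (hΔ : 0 < Δ) (hg : LipschitzOnWith K g Θ)
    (hmono : ∀ x ∈ Θ, ∀ y ∈ Θ, 0 ≤ ⟪g y - g x, y - x⟫)
    (hθ : ∀ b, IsVISol Θ g Δ b (θ b)) : Continuous (perturbationInv g θ Δ) := by
  have h : Continuous fun b => g (θ b) :=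
    hg.continuousOn.comp_continuous (continuous_of_isVISol hΔ hmono hθ) fun b => (hθ b).1
  exact ((continuous_id.add h).const_smul Δ⁻¹).neg

/-- Replacing one positive summand `h₂` of rank at most `R` of the Jacobian of `g` by another one
`h₁` changes the Jacobian determinant of `perturbationMap` by a factor of at most
`(1 + η / Δ) ^ R`. -/
theorem abs_det_fderiv_perturbationMap_le [FiniteDimensional ℝ E] {g₁ g₂ : E → E}
    {H h₁ h₂ P : E →L[ℝ] E} {y : E} {η : ℝ} {R : ℕ} (hp : IsConvexProj Θ p) (hΔ : 0 < Δ)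
    (hη : 0 ≤ η) (hP : HasFDerivAt p P y)
    (hg₁ : HasFDerivAt g₁ (H + h₁) (p y)) (hg₂ : HasFDerivAt g₂ (H + h₂) (p y))
    (hH : (H : E →ₗ[ℝ] E).IsSymmetric) (hH0 : ∀ v, 0 ≤ ⟪H v, v⟫)
    (hh₁ : (h₁ : E →ₗ[ℝ] E).IsSymmetric) (h₁0 : ∀ v, 0 ≤ ⟪h₁ v, v⟫)
    (h₁1 : ∀ v, ⟪h₁ v, v⟫ ≤ η * ‖v‖ ^ 2)
    (hR₁ : Module.finrank ℝ (LinearMap.range (h₁ : E →ₗ[ℝ] E)) ≤ R)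
    (hh₂ : (h₂ : E →ₗ[ℝ] E).IsSymmetric) (h₂0 : ∀ v, 0 ≤ ⟪h₂ v, v⟫)
    (h₂1 : ∀ v, ⟪h₂ v, v⟫ ≤ η * ‖v‖ ^ 2)
    (hR₂ : Module.finrank ℝ (LinearMap.range (h₂ : E →ₗ[ℝ] E)) ≤ R) :
    (fderiv ℝ (perturbationMap p g₂ Δ) y).det ≠ 0 ∧
      |(fderiv ℝ (perturbationMap p g₁ Δ) y).det| ≤
        (1 + η / Δ) ^ R * |(fderiv ℝ (perturbationMap p g₂ Δ) y).det| := by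
  have := FiniteDimensional.complete ℝ E
  have hder : ∀ {g : E → E} {h : E →L[ℝ] E}, HasFDerivAt g (H + h) (p y) →
      |(fderiv ℝ (perturbationMap p g Δ) y).det| =
        |LinearMap.det (Δ • 1 + ((H : E →ₗ[ℝ] E) + (h : E →ₗ[ℝ] E)) ∘ₗ (P : E →ₗ[ℝ] E))| := by
    intro g h hg
    have h1 : HasFDerivAt (perturbationMap p g Δ)
        (-(Δ • ContinuousLinearMap.id ℝ E + (H + h).comp P)) y :=
      (((hasFDerivAt_id y).const_smul Δ).add (hg.comp y hP)).neg
    rw [h1.fderiv, ContinuousLinearMap.det]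
    have h2 : ((-(Δ • ContinuousLinearMap.id ℝ E + (H + h).comp P) : E →L[ℝ] E) : E →ₗ[ℝ] E) =
        (-1 : ℝ) • (Δ • 1 + ((H : E →ₗ[ℝ] E) + (h : E →ₗ[ℝ] E)) ∘ₗ (P : E →ₗ[ℝ] E)) := by
      ext v
      simp
      abel
    rw [h2, LinearMap.det_smul, abs_mul, abs_pow, abs_neg, abs_one, one_pow, one_mul]
  have hPs := hp.isSymmetric_of_hasFDerivAt hP
  have hP1 := hp.sq_norm_le_inner_of_hasFDerivAt hP
  obtain ⟨hne, r₁, hr₁, e₁⟩ := det_smul_add_comp_ratio hΔ hη hH hH0 hPs hP1 hh₁ h₁0 h₁1 hR₁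
  obtain ⟨-, r₂, hr₂, e₂⟩ := det_smul_add_comp_ratio hΔ hη hH hH0 hPs hP1 hh₂ h₂0 h₂1 hR₂
  have hpos := abs_pos.2 hne
  rw [← abs_ne_zero, hder hg₁, hder hg₂, e₁, e₂, abs_mul, abs_mul,
    abs_of_pos (zero_lt_one.trans_le hr₁.1), abs_of_pos (zero_lt_one.trans_le hr₂.1)]
  refine ⟨(mul_pos (zero_lt_one.trans_le hr₂.1) hpos).ne', ?_⟩
  calc r₁ * _ ≤ (1 + η / Δ) ^ R * (1 * _) := by
        rw [one_mul]; exact mul_le_mul_of_nonneg_right hr₁.2 hpos.le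
    _ ≤ _ := by
        refine mul_le_mul_of_nonneg_left (mul_le_mul_of_nonneg_right hr₂.1 hpos.le) (by positivity)

end Privacy

section Privacy

/-! ### Privacy of the perturbed variational inequality -/

theorem isoGaussianPDF_div {d : ℕ} {v : ℝ} (hv : 0 < v) (x y : EuclideanSpace ℝ (Fin d)) :
    isoGaussianPDF v x / isoGaussianPDF v y = Real.exp ((2 * v)⁻¹ * (‖y‖ ^ 2 - ‖x‖ ^ 2)) := by
  rw [isoGaussianPDF, isoGaussianPDF, mul_div_mul_left _ _ (by positivity), ← Real.exp_sub]
  congr 1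
  ring

/-- The Rényi divergence between the laws of the solutions of two variational inequalities with a
common Gaussian perturbation. By the change of variables `perturbationMap` and data processing it
suffices to bound the ratio of two densities. The Jacobian determinants contribute `exp κ` and the
Gaussian densities, at points at distance at most `2 L`, the rest. -/
theorem renyiDiv_map_isVISol_le {d : ℕ} (hd : 0 < d) {Θ : Set (EuclideanSpace ℝ (Fin d))}
    {p g₁ g₂ θ₁ θ₂ : EuclideanSpace ℝ (Fin d) → EuclideanSpace ℝ (Fin d)}
    {Δ σ L κ ε α : ℝ} {K₁ K₂ : ℝ≥0} (hp : IsConvexProj Θ p) (hΔ : 0 < Δ) (hσ : 0 < σ) (hL : 0 ≤ L)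
    (hκ : 0 ≤ κ) (hε : 2 * L ^ 2 + 2 * L * σ * √d ≤ ε * σ ^ 2) (hα : 1 < α)
    (hmono₁ : ∀ x ∈ Θ, ∀ y ∈ Θ, 0 ≤ ⟪g₁ y - g₁ x, y - x⟫)
    (hmono₂ : ∀ x ∈ Θ, ∀ y ∈ Θ, 0 ≤ ⟪g₂ y - g₂ x, y - x⟫)
    (hlip₁ : LipschitzOnWith K₁ g₁ Θ) (hlip₂ : LipschitzOnWith K₂ g₂ Θ)
    (hθ₁ : ∀ b, IsVISol Θ g₁ Δ b (θ₁ b)) (hθ₂ : ∀ b, IsVISol Θ g₂ Δ b (θ₂ b))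
    (hsub : ∀ x ∈ Θ, ‖g₁ x - g₂ x‖ ≤ 2 * L)
    (hdet : ∀ᵐ y, (fderiv ℝ (perturbationMap p g₂ Δ) y).det ≠ 0 ∧
      |(fderiv ℝ (perturbationMap p g₁ Δ) y).det| ≤
        Real.exp κ * |(fderiv ℝ (perturbationMap p g₂ Δ) y).det|) :
    renyiDiv α
      ((multivariateGaussian (0 : EuclideanSpace ℝ (Fin d))
        (σ ^ 2 • (1 : Matrix (Fin d) (Fin d) ℝ))).map θ₁)
      ((multivariateGaussian (0 : EuclideanSpace ℝ (Fin d))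
        (σ ^ 2 • (1 : Matrix (Fin d) (Fin d) ℝ))).map θ₂) ≤ (((κ + ε) * α : ℝ) : EReal) := by
  have hα1 : 0 < α - 1 := by linarith
  have hv : 0 < σ ^ 2 := by positivity
  obtain ⟨C₁, hC₁⟩ := exists_lipschitzWith_perturbationMap (Δ := Δ) hp hlip₁
  obtain ⟨C₂, hC₂⟩ := exists_lipschitzWith_perturbationMap (Δ := Δ) hp hlip₂
  set T₁ := perturbationMap p g₁ Δ with hT₁
  set T₂ := perturbationMap p g₂ Δ with hT₂
  set Y₁ := perturbationInv g₁ θ₁ Δ with hY₁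
  set Y₂ := perturbationInv g₂ θ₂ Δ with hY₂
  have hY₁m : Measurable Y₁ := (continuous_perturbationInv hΔ hlip₁ hmono₁ hθ₁).measurable
  have hY₂m : Measurable Y₂ := (continuous_perturbationInv hΔ hlip₂ hmono₂ hθ₂).measurable
  have hpm : Measurable p := hp.lipschitzWith.continuous.measurable
  set φ : EuclideanSpace ℝ (Fin d) → ℝ≥0∞ := fun x => ENNReal.ofReal (isoGaussianPDF (σ ^ 2) x)
    with hφ
  have hφm : Measurable φ := (continuous_isoGaussianPDF _).measurable.ennreal_ofReal
  set γ := multivariateGaussian (0 : EuclideanSpace ℝ (Fin d))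
    (σ ^ 2 • (1 : Matrix (Fin d) (Fin d) ℝ)) with hγ
  have hγφ : γ = volume.withDensity φ := multivariateGaussian_eq_withDensity hv
  have hlaw₁ := map_withDensity_eq_of_lipschitzWith hC₁ hY₁m
    (perturbationInv_perturbationMap hp hΔ hmono₁ hθ₁)
    (perturbationMap_perturbationInv hp hΔ hθ₁) φ
  have hlaw₂ := map_withDensity_eq_of_lipschitzWith hC₂ hY₂m
    (perturbationInv_perturbationMap hp hΔ hmono₂ hθ₂)
    (perturbationMap_perturbationInv hp hΔ hθ₂) φ
  rw [← hγφ] at hlaw₁ hlaw₂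
  set f₁ : EuclideanSpace ℝ (Fin d) → ℝ≥0∞ :=
    fun y => ENNReal.ofReal |(fderiv ℝ T₁ y).det| * φ (T₁ y) with hf₁
  set f₂ : EuclideanSpace ℝ (Fin d) → ℝ≥0∞ :=
    fun y => ENNReal.ofReal |(fderiv ℝ T₂ y).det| * φ (T₂ y) with hf₂
  have hdetm : ∀ T : EuclideanSpace ℝ (Fin d) → EuclideanSpace ℝ (Fin d),
      Measurable fun y => ENNReal.ofReal |(fderiv ℝ T y).det| := fun T =>
    (continuous_abs.measurable.comp
      (ContinuousLinearMap.continuous_det.measurable.comp (measurable_fderiv ℝ T))).ennreal_ofReal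
  have hf₁m : Measurable f₁ := (hdetm T₁).mul (hφm.comp hC₁.continuous.measurable)
  have hf₂m : Measurable f₂ := (hdetm T₂).mul (hφm.comp hC₂.continuous.measurable)
  have hf₂0 : ∀ᵐ y, f₂ y ≠ 0 := by
    filter_upwards [hdet] with y hy
    exact mul_ne_zero (ENNReal.ofReal_pos.2 (abs_pos.2 hy.1)).ne'
      (ENNReal.ofReal_pos.2 (isoGaussianPDF_pos hv _)).ne'
  have hf₂top : ∀ᵐ y, f₂ y ≠ ∞ := Filter.Eventually.of_forall fun y =>
    ENNReal.mul_ne_top ENNReal.ofReal_ne_top ENNReal.ofReal_ne_top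
  have hmap₁ : γ.map θ₁ = (volume.withDensity f₁).map p := by
    rw [← hlaw₁, Measure.map_map hpm hY₁m]
    congr 1
    exact funext fun b => (proj_perturbationInv hp hΔ hθ₁ b).symm
  have hmap₂ : γ.map θ₂ = (volume.withDensity f₂).map p := by
    rw [← hlaw₂, Measure.map_map hpm hY₂m]
    congr 1
    exact funext fun b => (proj_perturbationInv hp hΔ hθ₂ b).symm
  have : IsFiniteMeasure (volume.withDensity f₁) := hlaw₁ ▸ inferInstance
  have : IsFiniteMeasure (volume.withDensity f₂) := hlaw₂ ▸ inferInstance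
  rw [hmap₁, hmap₂]
  refine renyiDiv_map_withDensity_le hf₁m hf₂m hf₂0 hf₂top hpm hα ?_
  -- the exponential rate of the Gaussian part of the ratio as a function of `‖T₁ y‖`
  set t := (α - 1) * (2 * L / σ ^ 2) with ht
  have ht0 : 0 ≤ t := by positivity
  set A := (α - 1) * (κ + 2 * L ^ 2 / σ ^ 2) with hA
  have hratio : ∀ᵐ y, (f₁ y / f₂ y) ^ (α - 1) ≤
      ENNReal.ofReal (Real.exp A) * ENNReal.ofReal (Real.exp (t * ‖T₁ y‖)) := by
    filter_upwards [hdet] with y hy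
    have hpos : 0 < |(fderiv ℝ T₂ y).det| := abs_pos.2 hy.1
    have hφ₂ := isoGaussianPDF_pos hv (T₂ y)
    have hφ₁ := isoGaussianPDF_pos hv (T₁ y)
    have hnorm : ‖T₂ y‖ ≤ ‖T₁ y‖ + 2 * L := by
      have h1 : T₂ y = T₁ y + (g₁ (p y) - g₂ (p y)) := by
        rw [hT₁, hT₂, perturbationMap, perturbationMap]; abel
      rw [h1]
      exact (norm_add_le _ _).trans (by gcongr; exact hsub _ (hp.mem y))
    have hsq : ‖T₂ y‖ ^ 2 - ‖T₁ y‖ ^ 2 ≤ 4 * L * ‖T₁ y‖ + 4 * L ^ 2 := by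
      have : ‖T₂ y‖ ^ 2 ≤ (‖T₁ y‖ + 2 * L) ^ 2 := by gcongr
      linarith
    have hreal : |(fderiv ℝ T₁ y).det| * isoGaussianPDF (σ ^ 2) (T₁ y) /
        (|(fderiv ℝ T₂ y).det| * isoGaussianPDF (σ ^ 2) (T₂ y)) ≤
        Real.exp (κ + (2 * σ ^ 2)⁻¹ * (4 * L * ‖T₁ y‖ + 4 * L ^ 2)) := by
      rw [mul_div_mul_comm, isoGaussianPDF_div hv, Real.exp_add]
      refine mul_le_mul ?_ (Real.exp_le_exp.2 (by gcongr)) (Real.exp_pos _).le (Real.exp_pos _).le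
      rw [div_le_iff₀ hpos]
      exact hy.2
    have h1 : f₁ y / f₂ y ≤
        ENNReal.ofReal (Real.exp (κ + (2 * σ ^ 2)⁻¹ * (4 * L * ‖T₁ y‖ + 4 * L ^ 2))) := by
      rw [hf₁, hf₂, hφ]
      simp only
      rw [← ENNReal.ofReal_mul (abs_nonneg _), ← ENNReal.ofReal_mul (abs_nonneg _),
        ← ENNReal.ofReal_div_of_pos (by positivity)]
      exact ENNReal.ofReal_le_ofReal hreal
    refine (ENNReal.rpow_le_rpow h1 hα1.le).trans_eq ?_
    rw [ENNReal.ofReal_rpow_of_pos (Real.exp_pos _), ← Real.exp_mul,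
      ← ENNReal.ofReal_mul (Real.exp_pos _).le, ← Real.exp_add]
    congr 2
    rw [hA, ht]
    field_simp
    ring
  calc ∫⁻ y, (f₁ y / f₂ y) ^ (α - 1) ∂(volume.withDensity f₁)
      ≤ ∫⁻ y, ENNReal.ofReal (Real.exp A) * ENNReal.ofReal (Real.exp (t * ‖T₁ y‖))
          ∂(volume.withDensity f₁) :=
        lintegral_mono_ae ((withDensity_absolutelyContinuous _ _).ae_le hratio)
    _ = ∫⁻ b, ENNReal.ofReal (Real.exp A) * ENNReal.ofReal (Real.exp (t * ‖b‖)) ∂γ := by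
        have hTc := hC₁.continuous
        rw [← hlaw₁, lintegral_map (by fun_prop) hY₁m]
        refine lintegral_congr fun b => ?_
        rw [show T₁ (Y₁ b) = b from perturbationMap_perturbationInv hp hΔ hθ₁ b]
    _ ≤ ENNReal.ofReal (Real.exp A) *
          ENNReal.ofReal (Real.exp (t * σ * √d + (t * σ) ^ 2 / 2)) := by
        rw [lintegral_const_mul _ (by fun_prop)]
        gcongr
        exact lintegral_exp_norm_multivariateGaussian_le hd hσ ht0
    _ ≤ ENNReal.ofReal (Real.exp ((α - 1) * ((κ + ε) * α))) := by
        rw [← ENNReal.ofReal_mul (Real.exp_pos _).le, ← Real.exp_add]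
        refine ENNReal.ofReal_le_ofReal (Real.exp_le_exp.2 ?_)
        set x := L / σ with hx
        have hx0 : 0 ≤ x := by positivity
        have hLx : L = x * σ := by rw [hx]; field_simp
        have hεx : 2 * x ^ 2 + 2 * x * √d ≤ ε := by
          refine le_of_mul_le_mul_right ?_ hv
          rw [hLx] at hε
          linarith
        have h1 : A + (t * σ * √d + (t * σ) ^ 2 / 2) =
            (α - 1) * (κ + (2 * x ^ 2 * α + 2 * x * √d)) := by
          rw [hA, ht, hLx]
          field_simp
          ring
        rw [h1]
        refine mul_le_mul_of_nonneg_left ?_ hα1.le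
        have h2 : 0 ≤ (α - 1) * (2 * x * √d) := by positivity
        have h3 : 0 ≤ (α - 1) * κ := by positivity
        have h4 : (2 * x ^ 2 + 2 * x * √d) * α ≤ ε * α :=
          mul_le_mul_of_nonneg_right hεx (by linarith)
        linarith

end Privacy

section ObjectivePerturbation

/-! ### Objective perturbation -/

theorem hasGradientAt_of_differentiableOn {E : Type*} [NormedAddCommGroup E]
    [InnerProductSpace ℝ E] [CompleteSpace E] {f : E → ℝ} {U : Set E} {x : E} (hU : IsOpen U)
    (hf : DifferentiableOn ℝ f U) (hx : x ∈ U) : HasGradientAt f (gradient f x) x :=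
  (hf.differentiableAt (hU.mem_nhds hx)).hasGradientAt

theorem isSymmetric_hessian {d : ℕ} {f : EuclideanSpace ℝ (Fin d) → ℝ}
    {U : Set (EuclideanSpace ℝ (Fin d))} {x : EuclideanSpace ℝ (Fin d)} (hU : IsOpen U)
    (hf : DifferentiableOn ℝ f U) (hf2 : DifferentiableOn ℝ (gradient f) U) (hx : x ∈ U) :
    (hessian f x).IsSymmetric :=
  HasFDerivAt.isSymmetric_of_hasGradientAt
    (Filter.mem_of_superset (hU.mem_nhds hx)
      fun _ hy => hasGradientAt_of_differentiableOn hU hf hy)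
    (hf2.differentiableAt (hU.mem_nhds hx)).hasFDerivAt

theorem inner_hessian_nonneg {d : ℕ} {f : EuclideanSpace ℝ (Fin d) → ℝ}
    {U : Set (EuclideanSpace ℝ (Fin d))} {x : EuclideanSpace ℝ (Fin d)} (hU : IsOpen U)
    (hc : ConvexOn ℝ U f) (hf : DifferentiableOn ℝ f U)
    (hf2 : DifferentiableOn ℝ (gradient f) U) (hx : x ∈ U) (v : EuclideanSpace ℝ (Fin d)) :
    0 ≤ ⟪fderiv ℝ (gradient f) x v, v⟫ := by
  have h := (hf2.differentiableAt (hU.mem_nhds hx)).hasFDerivAt.mul_sq_norm_le_inner (c := 0)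
    (Filter.mem_of_superset (hU.mem_nhds hx) fun y hy => by
      simpa using hc.inner_gradient_sub_nonneg hx hy
        (hasGradientAt_of_differentiableOn hU hf hx) (hasGradientAt_of_differentiableOn hU hf hy)) v
  simpa using h

/-- The condition on the noise level, solved for `ε`. With `s = √d` and `x = L / σ` it reads
`2 x² + 2 x s ≤ ε`, the bound on the exponent contributed by the Gaussian densities. -/
theorem mul_add_le_of_sigma_bound {s L ε σ : ℝ} (hL : 0 ≤ L) (hε : 0 < ε)
    (hs : 0 ≤ s) (hσ : 0 < σ) (h : L * (√(s ^ 2 + 2 * ε) + s) ≤ ε * σ) :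
    2 * L ^ 2 + 2 * L * σ * s ≤ ε * σ ^ 2 := by
  set a := √(s ^ 2 + 2 * ε) with ha
  have ha2 : a ^ 2 = s ^ 2 + 2 * ε := Real.sq_sqrt (by positivity)
  have ha0 : 0 < a := Real.sqrt_pos.2 (by positivity)
  -- rationalization: `ε = (a - s) (a + s) / 2`
  have h1 : 2 * L ≤ (a - s) * σ := by
    refine le_of_mul_le_mul_right ?_ (by positivity : 0 < a + s)
    nlinarith
  have h2 : (2 * L + s * σ) ^ 2 ≤ (a * σ) ^ 2 := by
    have : 0 ≤ 2 * L + s * σ := by positivity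
    gcongr
    linarith
  have h3 : (a * σ) ^ 2 = (s ^ 2 + 2 * ε) * σ ^ 2 := by rw [mul_pow, ha2]
  linarith

/-- The condition on the regularization strength bounds the Jacobian ratio by `exp κ`. The maximum
with `0` covers `η < 0`, which forces the Hessians to act on the zero space. -/
theorem one_add_max_div_pow_le {η Δ κ : ℝ} {R : ℕ} (hR : 0 < R) (hΔ : 0 < Δ) (hκ : 0 < κ)
    (h : η / (Real.exp (κ / R) - 1) ≤ Δ) : (1 + max η 0 / Δ) ^ R ≤ Real.exp κ := by
  have hR' : (0 : ℝ) < R := by exact_mod_cast hR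
  have he : 0 < Real.exp (κ / R) - 1 := by
    have : 0 < κ / R := by positivity
    linarith [Real.add_one_lt_exp this.ne']
  have h1 : max η 0 / Δ ≤ Real.exp (κ / R) - 1 := by
    rw [div_le_iff₀ hΔ, mul_comm]
    exact max_le ((div_le_iff₀ he).1 h) (by positivity)
  calc (1 + max η 0 / Δ) ^ R ≤ Real.exp (κ / R) ^ R := by
        gcongr
        linarith
    _ = Real.exp κ := by
        rw [← Real.exp_nat_mul]
        congr 1
        field_simp

end ObjectivePerturbation

theorem mainTheorem2 {D : Type*} {d n : ℕ}
    (ℓ : EuclideanSpace ℝ (Fin d) → D → ℝ)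
    -- the parameter set, inside an open domain on which the losses are defined
    (Θ U : Set (EuclideanSpace ℝ (Fin d)))
    (hΘ_nonempty : Θ.Nonempty) (hΘ_closed : IsClosed Θ) (hΘ_convex : Convex ℝ Θ)
    (hU_open : IsOpen U) (hΘU : Θ ⊆ U)
    (L η : ℝ) (R : ℕ) (hR : 0 < R)
    -- each loss is convex and twice differentiable
    (h_convex : ∀ z, ConvexOn ℝ U (fun θ => ℓ θ z))
    (h_diff : ∀ z, DifferentiableOn ℝ (fun θ => ℓ θ z) U)
    (h_diff_two : ∀ z, DifferentiableOn ℝ (gradient fun θ => ℓ θ z) U)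
    -- bounds on the gradient and on the eigenvalues and the rank of the Hessian
    (h_grad : ∀ θ ∈ Θ, ∀ z, ‖gradient (fun θ => ℓ θ z) θ‖ ≤ L)
    (h_eig : ∀ θ ∈ Θ, ∀ z, ∀ μ : ℝ,
      Module.End.HasEigenvalue (hessian (fun θ => ℓ θ z) θ) μ → μ ≤ η)
    (h_rank : ∀ θ ∈ Θ, ∀ z,
      Module.finrank ℝ (LinearMap.range (hessian (fun θ => ℓ θ z) θ)) ≤ R)
    (ρ q Δ σ : ℝ) (hρ : 0 < ρ) (hq : q ∈ Set.Ioo (0 : ℝ) 1) (hΔ_pos : 0 < Δ)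
    (hΔ : η / (Real.exp ((1 - q) * ρ / R) - 1) ≤ Δ)
    (hσ : (L * (Real.sqrt (d + 2 * q * ρ) + Real.sqrt d) / (q * ρ)) ^ 2 ≤ σ ^ 2) :
    (∀ (Z : Fin n → D) (b : EuclideanSpace ℝ (Fin d)),
      ∃! θ, θ ∈ Θ ∧ IsMinOn (perturbedObjective ℓ Δ Z b) Θ θ) ∧
    IsZCDP ρ (fun Z : Fin n → D => objectivePerturbation ℓ Θ Δ σ Z) := by
  set G : D → EuclideanSpace ℝ (Fin d) → EuclideanSpace ℝ (Fin d) :=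
    fun z => gradient fun θ => ℓ θ z with hG
  set Hs : D → EuclideanSpace ℝ (Fin d) →
      EuclideanSpace ℝ (Fin d) →L[ℝ] EuclideanSpace ℝ (Fin d) :=
    fun z x => fderiv ℝ (G z) x with hHs
  set g : (Fin n → D) → EuclideanSpace ℝ (Fin d) → EuclideanSpace ℝ (Fin d) :=
    fun Z x => ∑ i, G (Z i) x with hg
  set η' := max η 0 with hη'
  have hη'0 : 0 ≤ η' := le_max_right _ _
  have hGgrad : ∀ z, ∀ x ∈ Θ, HasGradientAt (fun θ => ℓ θ z) (G z x) x := fun z x hx =>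
    hasGradientAt_of_differentiableOn hU_open (h_diff z) (hΘU hx)
  have hGle : ∀ z, ∀ x ∈ Θ, ∀ w ∈ Θ, ⟪G z x, w - x⟫ ≤ ℓ w z - ℓ x z := fun z x hx w hw =>
    (h_convex z).inner_gradient_le (hΘU hx) (hΘU hw) (hGgrad z x hx)
  have hGderiv : ∀ z, ∀ x ∈ Θ, HasFDerivAt (G z) (Hs z x) x := fun z x hx =>
    ((h_diff_two z).differentiableAt (hU_open.mem_nhds (hΘU hx))).hasFDerivAt
  have hHsym : ∀ z, ∀ x ∈ Θ,
      (Hs z x : EuclideanSpace ℝ (Fin d) →ₗ[ℝ] EuclideanSpace ℝ (Fin d)).IsSymmetric :=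
    fun z x hx => isSymmetric_hessian hU_open (h_diff z) (h_diff_two z) (hΘU hx)
  have hH0 : ∀ z, ∀ x ∈ Θ, ∀ v, 0 ≤ ⟪Hs z x v, v⟫ := fun z x hx =>
    inner_hessian_nonneg hU_open (h_convex z) (h_diff z) (h_diff_two z) (hΘU hx)
  have hH1 : ∀ z, ∀ x ∈ Θ, ∀ v, ⟪Hs z x v, v⟫ ≤ η' * ‖v‖ ^ 2 := fun z x hx v =>
    (hHsym z x hx).inner_le_of_hasEigenvalue_le
      (fun μ hμ => (h_eig x hx z μ hμ).trans (le_max_left _ _)) v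
  have hHnorm : ∀ z, ∀ x ∈ Θ, ‖Hs z x‖ ≤ η' := fun z x hx =>
    (hHsym z x hx).norm_le_of_inner_le hη'0 (hH0 z x hx) (hH1 z x hx)
  have hFgrad : ∀ Z : Fin n → D, ∀ x ∈ Θ, HasGradientAt (fun θ => ∑ i, ℓ θ (Z i)) (g Z x) x := by
    intro Z x hx
    rw [hasGradientAt_iff_hasFDerivAt, hg, map_sum]
    exact HasFDerivAt.fun_sum fun i _ => (hGgrad (Z i) x hx).hasFDerivAt
  have hFle : ∀ Z : Fin n → D, ∀ x ∈ Θ, ∀ w ∈ Θ,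
      ⟪g Z x, w - x⟫ ≤ ∑ i, ℓ w (Z i) - ∑ i, ℓ x (Z i) := by
    intro Z x hx w hw
    rw [hg, sum_inner, ← Finset.sum_sub_distrib]
    exact Finset.sum_le_sum fun i _ => hGle (Z i) x hx w hw
  have hmono : ∀ Z : Fin n → D, ∀ x ∈ Θ, ∀ y ∈ Θ, 0 ≤ ⟪g Z y - g Z x, y - x⟫ := by
    intro Z x hx y hy
    have h1 := hFle Z x hx y hy
    have h2 := hFle Z y hy x hx
    rw [← neg_sub y x, inner_neg_right] at h2
    rw [inner_sub_left]
    linarith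
  have hlip : ∀ Z : Fin n → D, LipschitzOnWith (∑ _i : Fin n, η'.toNNReal) (g Z) Θ := by
    intro Z
    refine Convex.lipschitzOnWith_of_nnnorm_hasFDerivWithin_le (𝕜 := ℝ)
      (f' := fun x => ∑ i, Hs (Z i) x) (fun x hx => ?_) (fun x hx => ?_) hΘ_convex
    · exact (HasFDerivAt.fun_sum fun i _ => hGderiv (Z i) x hx).hasFDerivWithinAt
    · refine (nnnorm_sum_le _ _).trans (Finset.sum_le_sum fun i _ => ?_)
      rw [← NNReal.coe_le_coe, coe_nnnorm, Real.coe_toNNReal _ hη'0]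
      exact hHnorm (Z i) x hx
  have hmin : ∀ (Z : Fin n → D) (b θ : EuclideanSpace ℝ (Fin d)),
      (θ ∈ Θ ∧ IsMinOn (perturbedObjective ℓ Δ Z b) Θ θ) ↔ IsVISol Θ (g Z) Δ b θ := by
    intro Z b θ
    refine ⟨fun h => ?_, fun h => ⟨h.1, ?_⟩⟩
    · exact (isMinOn_iff_isVISol hΔ_pos.le hΘ_convex h.1 (hFgrad Z θ h.1) (hFle Z θ h.1)).1 h.2
    · exact (isMinOn_iff_isVISol hΔ_pos.le hΘ_convex h.1 (hFgrad Z θ h.1) (hFle Z θ h.1)).2 h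
  have hex : ∀ (Z : Fin n → D) (b : EuclideanSpace ℝ (Fin d)),
      ∃ θ, θ ∈ Θ ∧ IsMinOn (perturbedObjective ℓ Δ Z b) Θ θ := by
    intro Z b
    obtain ⟨x, hx⟩ := hΘ_nonempty
    exact exists_isMinOn_objective hΔ_pos hΘ_closed hx
      (fun y hy => (hFgrad Z y hy).hasFDerivAt.continuousAt.continuousWithinAt) (hFle Z x hx)
  have hsol : ∀ (Z : Fin n → D) (b : EuclideanSpace ℝ (Fin d)),
      IsVISol Θ (g Z) Δ b (perturbedMinimizer ℓ Θ Δ Z b) := fun Z b =>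
    (hmin Z b _).1 (Classical.epsilon_spec (hex Z b))
  have hcont : ∀ Z : Fin n → D, Continuous (perturbedMinimizer ℓ Θ Δ Z) := fun Z =>
    continuous_of_isVISol hΔ_pos (hmono Z) (hsol Z)
  have hprob : ∀ Z : Fin n → D, IsProbabilityMeasure (objectivePerturbation ℓ Θ Δ σ Z) :=
    fun Z => Measure.isProbabilityMeasure_map (hcont Z).aemeasurable
  refine ⟨fun Z b => ?_, hprob, fun Z Z' ⟨t, ht⟩ α hα => ?_⟩
  · obtain ⟨θ, hθ⟩ := hex Z b
    exact ⟨θ, hθ, fun θ' hθ' =>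
      ((hmin Z b θ').1 hθ').unique hΔ_pos (hmono Z) ((hmin Z b θ).1 hθ)⟩
  -- equal minimizers have equal laws, at divergence zero
  have htriv : (∀ b, perturbedMinimizer ℓ Θ Δ Z b = perturbedMinimizer ℓ Θ Δ Z' b) →
      renyiDiv α (objectivePerturbation ℓ Θ Δ σ Z) (objectivePerturbation ℓ Θ Δ σ Z') ≤
        ((ρ * α : ℝ) : EReal) := by
    intro h
    have h1 : objectivePerturbation ℓ Θ Δ σ Z = objectivePerturbation ℓ Θ Δ σ Z' := by
      rw [objectivePerturbation, objectivePerturbation, funext h]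
    have := hprob Z'
    rw [h1]
    exact renyiDiv_self_le hα (by positivity)
  have hε : 0 < q * ρ := mul_pos hq.1 hρ
  have hκ : 0 < (1 - q) * ρ := mul_pos (by linarith [hq.2]) hρ
  -- in dimension zero there is a single point, and the exponential moment bound needs `0 < d`
  rcases Nat.eq_zero_or_pos d with rfl | hd
  · exact htriv fun b => Subsingleton.elim _ _
  have hL : 0 ≤ L := by
    obtain ⟨x, hx⟩ := hΘ_nonempty
    exact (norm_nonneg _).trans (h_grad x hx (Z t))
  have hroot : 0 < √((d : ℝ) + 2 * q * ρ) + √(d : ℝ) := by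
    have : 0 < (d : ℝ) + 2 * q * ρ := by nlinarith [(Nat.cast_nonneg d : (0 : ℝ) ≤ d)]
    positivity
  have hσ' : L * (√((d : ℝ) + 2 * q * ρ) + √(d : ℝ)) ≤ q * ρ * |σ| := by
    have h1 := sq_le_sq.1 hσ
    rw [abs_of_nonneg (by positivity), div_le_iff₀ hε] at h1
    linarith
  rcases eq_or_ne σ 0 with rfl | hσ0
  · -- without noise the Lipschitz constant vanishes, and with it all gradients
    rw [abs_zero, mul_zero] at hσ'
    have hL0 : L ≤ 0 := by
      by_contra! h
      exact absurd hσ' (not_le.2 (mul_pos h hroot))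
    have hg0 : ∀ Y : Fin n → D, ∀ x ∈ Θ, g Y x = 0 := fun Y x hx =>
      Finset.sum_eq_zero fun i _ => norm_le_zero_iff.1 ((h_grad x hx (Y i)).trans hL0)
    refine htriv fun b => ?_
    have h1 := hsol Z' b
    refine (hsol Z b).unique hΔ_pos (hmono Z) ⟨h1.1, ?_⟩
    rw [hg0 Z _ h1.1, ← hg0 Z' _ h1.1]
    exact h1.2
  obtain ⟨p, hp⟩ := exists_isConvexProj hΘ_nonempty hΘ_closed hΘ_convex
  -- the records other than `t` contribute the same summand to both gradients and Hessians
  have hcommon : ∀ Y : Fin n → D, ∀ x,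
      g Y x = ∑ i ∈ Finset.univ.erase t, G (Y i) x + G (Y t) x := fun Y x =>
    (Finset.sum_erase_add _ _ (Finset.mem_univ t)).symm
  have herase : ∀ {M : Type _} [AddCommMonoid M] (φ : D → M),
      ∑ i ∈ Finset.univ.erase t, φ (Z i) = ∑ i ∈ Finset.univ.erase t, φ (Z' i) := fun φ =>
    Finset.sum_congr rfl fun i hi => by rw [ht i (Finset.ne_of_mem_erase hi)]
  have hsub : ∀ x ∈ Θ, ‖g Z x - g Z' x‖ ≤ 2 * L := by
    intro x hx
    rw [hcommon Z, hcommon Z', herase fun z => G z x, add_sub_add_left_eq_sub]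
    refine (norm_sub_le _ _).trans ?_
    linarith [h_grad x hx (Z t), h_grad x hx (Z' t)]
  have hdet : ∀ᵐ y, (fderiv ℝ (perturbationMap p (g Z') Δ) y).det ≠ 0 ∧
      |(fderiv ℝ (perturbationMap p (g Z) Δ) y).det| ≤
        Real.exp ((1 - q) * ρ) * |(fderiv ℝ (perturbationMap p (g Z') Δ) y).det| := by
    filter_upwards [hp.lipschitzWith.ae_differentiableAt] with y hy
    have hx := hp.mem y
    set H := ∑ i ∈ Finset.univ.erase t, Hs (Z i) (p y) with hH
    have hder : ∀ Y : Fin n → D, H = ∑ i ∈ Finset.univ.erase t, Hs (Y i) (p y) →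
        HasFDerivAt (g Y) (H + Hs (Y t) (p y)) (p y) := by
      intro Y hY
      rw [hY, Finset.sum_erase_add _ _ (Finset.mem_univ t)]
      exact HasFDerivAt.fun_sum fun i _ => hGderiv (Y i) _ hx
    have hHapp : ∀ v, H v = ∑ i ∈ Finset.univ.erase t, Hs (Z i) (p y) v := fun v => by
      rw [hH, _root_.sum_apply]
    have hHs' : (H : EuclideanSpace ℝ (Fin d) →ₗ[ℝ] EuclideanSpace ℝ (Fin d)).IsSymmetric := by
      intro v w
      rw [ContinuousLinearMap.coe_coe, hHapp, hHapp, sum_inner, inner_sum]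
      exact Finset.sum_congr rfl fun i _ => hHsym (Z i) _ hx v w
    have hHpos : ∀ v, 0 ≤ ⟪H v, v⟫ := fun v => by
      rw [hHapp, sum_inner]
      exact Finset.sum_nonneg fun i _ => hH0 (Z i) _ hx v
    have h := abs_det_fderiv_perturbationMap_le hp hΔ_pos hη'0 hy.hasFDerivAt
      (hder Z rfl) (hder Z' (herase fun z => Hs z (p y))) hHs' hHpos
      (hHsym _ _ hx) (hH0 _ _ hx) (hH1 _ _ hx) (h_rank _ hx _)
      (hHsym _ _ hx) (hH0 _ _ hx) (hH1 _ _ hx) (h_rank _ hx _)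
    refine ⟨h.1, h.2.trans ?_⟩
    exact mul_le_mul_of_nonneg_right (one_add_max_div_pow_le hR hΔ_pos hκ hΔ) (abs_nonneg _)
  have hbound : 2 * L ^ 2 + 2 * L * |σ| * √(d : ℝ) ≤ q * ρ * |σ| ^ 2 := by
    refine mul_add_le_of_sigma_bound hL hε (Real.sqrt_nonneg _) (abs_pos.2 hσ0) ?_
    rw [Real.sq_sqrt (Nat.cast_nonneg d), ← mul_assoc]
    exact hσ'
  have hfinal := renyiDiv_map_isVISol_le hd hp hΔ_pos (abs_pos.2 hσ0) hL hκ.le hbound hα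
    (hmono Z) (hmono Z') (hlip Z) (hlip Z') (hsol Z) (hsol Z') hsub hdet
  rw [sq_abs, show (1 - q) * ρ + q * ρ = ρ by ring] at hfinal
  exact hfinal
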